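/- All graphs are finite and simple. An ordered graph is a graph together with a linear order $\prec$ of its vertices; ``left'' means smaller in $\prec$. An ordered graph $G$ contains a copy of an ordered graph $H$ if some (not necessarily induced) subgraph of $G$, with the inherited vertex order, is isomorphic to $H$ by an order-preserving isomorphism. For an ordered graph $H$ let $f_\prec(H)\in\mathbb{N}\cup\{\infty\}$ be the supremum of the chromatic numbers $\chi(G)$ over all ordered graphs $G$ that contain no copy of $H$. Two edges cross if they can be named $uv$ and $u'v'$ with $u\prec u'\prec v\prec v'$. A bonnet is an ordered graph that has exactly $4$ or $5$ vertices and that either has vertices $u_1\prec u_2\preceq u_3\prec u_4\preceq u_5$ and edges $u_1u_2,u_1u_5,u_3u_4$, or has vertices $u_1\preceq u_2\prec u_3\preceq u_4\prec u_5$ and edges $u_1u_5,u_4u_5,u_2u_3$. An ordered path $u_1,\dots,u_n$ is a tangled path if there is an $i$ with $1<i<n$ such that $u_i$ is the leftmost or the rightmost vertex of the path and some edge of the subpath $u_1,\dots,u_i$ crosses some edge of the subpath $u_i,\dots,u_n$. An inner cut vertex of an ordered graph $G$ is a vertex $v$ that is neither leftmost nor rightmost in $G$ and for which there is no edge $uw$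 with $u\prec v\prec w$. A segment of $G$ is an induced subgraph $G[S]$ such that $|S|\ge 2$, $S$ is an interval of the vertex order, the leftmost vertex of $S$ is an inner cut vertex of $G$ or the leftmost vertex of $G$, the rightmost vertex of $S$ is an inner cut vertex of $G$ or the rightmost vertex of $G$, and no other vertex of $S$ is an inner cut vertex of $G$. The length of an edge $xy$ with $x\prec y$ is the number of vertices $v$ with $x\preceq v\prec y$. A shortest edge incident to a vertex $u$ is an edge of minimum length among the edges incident to $u$; for a set $U$ of vertices each having exactly one shortest incident edge, $S(U)$ denotes the set of these shortest edges. An ordered tree on at least two vertices is monotonically alternating if its vertex set can be partitioned into independent sets $L$ and $R$, with every vertex of $L$ to the left of every vertex of $R$, such that each vertex has exactly one shortest incident edge, the edge set equals $S(L)\cup S(R)$, and neither $S(L)$ nor $S(R)$ contains two crossing edges. Theorem. (a) An ordered tree $T$ contains neither a bonnet nor a tangled path if and only if each segment of $T$ is a monotonically alternating tree. (b) If $H$ is a connected ordered graph with $f_\prec(H)\neq\infty$, then each segment of $H$ is a monotonically alternating tree. -/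

import Mathlib

/-! An ordered graph is a simple graph `G : SimpleGraph V` on a linearly ordered vertex type `V`;
`u < v` means that `u` is to the left of `v`. -/

namespace OrderedGraph

/-- Two edges cross if, for a suitable naming of them as `uv` and `u'v'`, `u < u' < v < v'`. -/
def EdgesCross {V : Type*} [LinearOrder V] (e f : Sym2 V) : Prop :=
  ∃ u v u' v' : V,
    ((e = s(u, v) ∧ f = s(u', v')) ∨ (f = s(u, v) ∧ e = s(u', v'))) ∧
      u < u' ∧ u' < v ∧ v < v'

/-- `G` contains a copy of `H`: there is an order preserving isomorphism of `H` onto a (not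
necessarily induced) ordered subgraph of `G`. -/
def ContainsCopy {V W : Type*} [LinearOrder V] [LinearOrder W]
    (H : SimpleGraph V) (G : SimpleGraph W) : Prop :=
  ∃ φ : H →g G, StrictMono φ

/-- `fPrec H` is the supremum of the chromatic numbers of all (finite) ordered graphs that do not
contain a copy of `H`. Every finite ordered graph is isomorphic to one with vertex set `Fin n`. -/
noncomputable def fPrec {V : Type*} [LinearOrder V] (H : SimpleGraph V) : ℕ∞ :=
  sSup {c : ℕ∞ | ∃ (n : ℕ) (G : SimpleGraph (Fin n)),
    ¬ ContainsCopy H G ∧ c = G.chromaticNumber}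

/-- `G` contains a bonnet as an ordered subgraph: an ordered graph with `4` or `5` vertices
`u₁ < u₂ ≤ u₃ < u₄ ≤ u₅` and edges `u₁u₂`, `u₁u₅`, `u₃u₄`, or with `4` or `5` vertices
`u₁ ≤ u₂ < u₃ ≤ u₄ < u₅` and edges `u₁u₅`, `u₄u₅`, `u₂u₃`. In each case at most one of the
two weak inequalities is an equality, since there are at least `4` vertices. -/
def ContainsBonnet {V : Type*} [LinearOrder V] (G : SimpleGraph V) : Prop :=
  ∃ u₁ u₂ u₃ u₄ u₅ : V,
    (u₁ < u₂ ∧ u₂ ≤ u₃ ∧ u₃ < u₄ ∧ u₄ ≤ u₅ ∧ ¬ (u₂ = u₃ ∧ u₄ = u₅) ∧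
      G.Adj u₁ u₂ ∧ G.Adj u₁ u₅ ∧ G.Adj u₃ u₄) ∨
    (u₁ ≤ u₂ ∧ u₂ < u₃ ∧ u₃ ≤ u₄ ∧ u₄ < u₅ ∧ ¬ (u₁ = u₂ ∧ u₃ = u₄) ∧
      G.Adj u₁ u₅ ∧ G.Adj u₄ u₅ ∧ G.Adj u₂ u₃)

/-- A path `p` from `u` to `v` is tangled if it has a vertex `m`, different from its two ends, that
is leftmost or rightmost in `p`, such that some edge of the subpath from `u` to `m` crosses some
edge of the subpath from `m` to `v`. -/
def IsTangledPath {V : Type*} [LinearOrder V] {G : SimpleGraph V} {u v : V}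
    (p : G.Walk u v) : Prop :=
  p.IsPath ∧ ∃ (m : V) (hm : m ∈ p.support), m ≠ u ∧ m ≠ v ∧
    ((∀ w ∈ p.support, m ≤ w) ∨ (∀ w ∈ p.support, w ≤ m)) ∧
    ∃ e ∈ (p.takeUntil m hm).edges, ∃ f ∈ (p.dropUntil m hm).edges, EdgesCross e f

/-- `G` contains a tangled path as an ordered subgraph. -/
def ContainsTangledPath {V : Type*} [LinearOrder V] (G : SimpleGraph V) : Prop :=
  ∃ (u v : V) (p : G.Walk u v), IsTangledPath p

/-- An inner cut vertex: no edge `uw` satisfies `u < v < w`, and `v` is neither leftmost nor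
rightmost. -/
def IsInnerCutVertex {V : Type*} [LinearOrder V] (G : SimpleGraph V) (v : V) : Prop :=
  (¬ ∃ u w : V, G.Adj u w ∧ u < v ∧ v < w) ∧ ¬ IsBot v ∧ ¬ IsTop v

/-- `S` is the vertex set of a segment of `G`; the segment itself is `G.induce S`. -/
def IsSegment {V : Type*} [LinearOrder V] (G : SimpleGraph V) (S : Set V) : Prop :=
  S.Nontrivial ∧ S.OrdConnected ∧
    ∃ a b : V, IsLeast S a ∧ IsGreatest S b ∧
      (IsInnerCutVertex G a ∨ IsBot a) ∧ (IsInnerCutVertex G b ∨ IsTop b) ∧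
      ∀ x ∈ S, x ≠ a → x ≠ b → ¬ IsInnerCutVertex G x

/-- The length of an edge `xy` with `x < y`: the number of vertices `v` with `x ≤ v < y`. -/
noncomputable def edgeLength {V : Type*} [LinearOrder V] (e : Sym2 V) : ℕ :=
  (Set.Ico e.inf e.sup).ncard

/-- `e` is a shortest edge among all the edges of `G` incident to `x`. -/
def IsShortestEdge {V : Type*} [LinearOrder V] (G : SimpleGraph V) (x : V) (e : Sym2 V) : Prop :=
  e ∈ G.incidenceSet x ∧ ∀ f ∈ G.incidenceSet x, edgeLength e ≤ edgeLength f

/-- The set `S(U)` of the shortest edges incident to the vertices in `U`. -/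
def shortestEdges {V : Type*} [LinearOrder V] (G : SimpleGraph V) (U : Set V) : Set (Sym2 V) :=
  {e | ∃ u ∈ U, IsShortestEdge G u e}

/-- `T` is a monotonically alternating tree. In a finite tree on at least two vertices every vertex
has a shortest incident edge, so there the uniqueness clause says that each vertex has exactly one
of them. -/
def IsMonotonicallyAlternating {V : Type*} [LinearOrder V] (T : SimpleGraph V) : Prop :=
  T.IsTree ∧ ∃ L R : Set V, L ∪ R = Set.univ ∧ Disjoint L R ∧
    (∀ l ∈ L, ∀ r ∈ R, l < r) ∧
    (∀ x ∈ L, ∀ y ∈ L, ¬ T.Adj x y) ∧ (∀ x ∈ R, ∀ y ∈ R, ¬ T.Adj x y) ∧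
    (∀ u e f, IsShortestEdge T u e → IsShortestEdge T u f → e = f) ∧
    T.edgeSet = shortestEdges T L ∪ shortestEdges T R ∧
    (∀ e ∈ shortestEdges T L, ∀ f ∈ shortestEdges T L, ¬ EdgesCross e f) ∧
    (∀ e ∈ shortestEdges T R, ∀ f ∈ shortestEdges T R, ¬ EdgesCross e f)

end OrderedGraph

/-!
Bonnets come in two mirror images, of which `HasLeftBonnet` is one. A tangled path is cut at its
distinguished vertex into two legs; if this vertex is leftmost, the legs form a *fork*
(`HasFork`), otherwise they form a fork in the reversed order. Statements are proved for left
bonnets and forks, and transferred to the mirror images by passing to `Vᵒᵈ`.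

*Trees.* A monotonically alternating tree is a tree with a split of its vertices into a left part
and a right part such that each edge goes to the nearest neighbor of one of its ends and nearest
edges of vertices in the same part do not cross (`IsAlternatingSplit`,
`isMonotonicallyAlternating_iff`).

Such a split excludes bonnets and forks: in a fork with first vertex `m`, the leg with the farther
second vertex `c` must be the single edge `mc`, and the other leg cannot get beyond `c`
(`IsAlternatingSplit.not_edgesCross`). As a bonnet or the relevant part of a fork has no inner cut
vertex in its interior, it lies inside one segment (`exists_segment_hasLeftBonnet`,
`exists_segment_hasFork`), so it is enough to exclude these from each segment.

Conversely, a segment of a tree induces a tree each of whose inner vertices lies under an edge,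
since a path cannot cross a cut vertex twice. In such a tree without bonnets and forks no vertex has
neighbors on both sides (`not_adj_both_sides`), the vertices with right neighbors precede those with
left neighbors (`lt_of_adj_right_of_adj_left`), each edge is nearest for one of its ends
(`no_zigzag`), and crossing nearest edges would be the ends of a fork (`not_cross_nearest`).

*Connected graphs with finite `fPrec`.* Bonnets and triangles are avoided by shift graphs, whose
chromatic number is unbounded. For forks with legs of length at most `ℓ`, graphs of large chromatic
number are built by induction on the number `k + 1` of colors. From a graph `G` that is not
`k`-colorable, ordered graphs `X` with many blocks isomorphic to `G` are constructed. A star join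
takes `k + 1` consecutive copies of `X` and adds centers to the left of all of them, each with one
neighbor in each copy. It creates no short fork if the neighbors of distinct centers are far apart
(`not_hasFork_starJoin`). As all `k + 1` colors appear in each block, the neighbors can be chosen,
by averaging, so that each center kills a constant proportion of the colorings
(`BlockSystem.exists_extend`); after sufficiently many rounds no coloring is left
(`BlockSystem.exists_colorings_eq_empty`).

So a connected graph with finite `fPrec` has no bonnet, tangled path or triangle. A cycle without
triangles contains a bonnet or a fork with its leftmost vertex in it (`not_cycle_at_min`), so
the graph is a tree, and the statement on trees applies.
-/

namespace OrderedGraph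

open SimpleGraph

/-! ### Crossing edges, bonnets and forks -/

section Basic

variable {V : Type*} [LinearOrder V] {G : SimpleGraph V}

theorem edgesCross_orderDual {e f : Sym2 V} :
    EdgesCross (V := Vᵒᵈ) e f ↔ EdgesCross e f := by
  constructor
  · rintro ⟨u, v, u', v', h, h1, h2, h3⟩
    refine ⟨v', u', v, u, ?_, h3, h2, h1⟩
    rcases h with ⟨rfl, rfl⟩ | ⟨rfl, rfl⟩
    · exact Or.inr ⟨Sym2.eq_swap, Sym2.eq_swap⟩
    · exact Or.inl ⟨Sym2.eq_swap, Sym2.eq_swap⟩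
  · rintro ⟨u, v, u', v', h, h1, h2, h3⟩
    refine ⟨v', u', v, u, ?_, h3, h2, h1⟩
    rcases h with ⟨rfl, rfl⟩ | ⟨rfl, rfl⟩
    · exact Or.inr ⟨Sym2.eq_swap, Sym2.eq_swap⟩
    · exact Or.inl ⟨Sym2.eq_swap, Sym2.eq_swap⟩

theorem EdgesCross.symm {e f : Sym2 V} (h : EdgesCross e f) : EdgesCross f e := by
  obtain ⟨u, v, u', v', h, h'⟩ := h
  exact ⟨u, v, u', v', h.symm, h'⟩

theorem edgesCross_mk {u u' v v' : V} (h1 : u < u') (h2 : u' < v) (h3 : v < v') :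
    EdgesCross s(u, v) s(u', v') :=
  ⟨u, v, u', v', Or.inl ⟨rfl, rfl⟩, h1, h2, h3⟩

/-- The first of the two kinds of bonnets; the other kind is its mirror image. -/
def HasLeftBonnet (G : SimpleGraph V) : Prop :=
  ∃ u₁ u₂ u₃ u₄ u₅ : V, u₁ < u₂ ∧ u₂ ≤ u₃ ∧ u₃ < u₄ ∧ u₄ ≤ u₅ ∧ ¬ (u₂ = u₃ ∧ u₄ = u₅) ∧
      G.Adj u₁ u₂ ∧ G.Adj u₁ u₅ ∧ G.Adj u₃ u₄

/-- A fork: two paths of length at most `ℓ` that start in a common vertex `m`, meet nowhere else,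
stay to the right of `m`, and have a pair of crossing edges. Up to the bound on the lengths, forks
are the tangled paths whose distinguished vertex is leftmost. -/
def HasFork (ℓ : ℕ) (G : SimpleGraph V) : Prop :=
  ∃ (m u v : V) (p : G.Walk m u) (q : G.Walk m v), p.IsPath ∧ q.IsPath ∧
    p.length ≤ ℓ ∧ q.length ≤ ℓ ∧ (∀ x ∈ p.support, x ∈ q.support → x = m) ∧
    (∀ x ∈ p.support, m ≤ x) ∧ (∀ x ∈ q.support, m ≤ x) ∧
    ∃ e ∈ p.edges, ∃ f ∈ q.edges, EdgesCross e f

theorem containsBonnet_iff (G : SimpleGraph V) :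
    ContainsBonnet G ↔ HasLeftBonnet G ∨ HasLeftBonnet (V := Vᵒᵈ) G := by
  constructor
  · rintro ⟨u₁, u₂, u₃, u₄, u₅, h | ⟨h1, h2, h3, h4, h5, h6, h7, h8⟩⟩
    · exact Or.inl ⟨u₁, u₂, u₃, u₄, u₅, h⟩
    · exact Or.inr ⟨u₅, u₄, u₃, u₂, u₁, h4, h3, h2, h1, fun h => h5 ⟨h.2.symm, h.1.symm⟩,
        h7.symm, h6.symm, h8.symm⟩
  · rintro (⟨u₁, u₂, u₃, u₄, u₅, h⟩ | ⟨u₅, u₄, u₃, u₂, u₁, h4, h3, h2, h1, h5, h7, h6, h8⟩)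
    · exact ⟨u₁, u₂, u₃, u₄, u₅, Or.inl h⟩
    · exact ⟨u₁, u₂, u₃, u₄, u₅, Or.inr ⟨h1, h2, h3, h4, fun h => h5 ⟨h.2.symm, h.1.symm⟩,
        h6.symm, h7.symm, h8.symm⟩⟩

end Basic

/-! ### Walks and paths -/

section Walks

variable {V : Type*} {G : SimpleGraph V}

theorem edges_takeUntil_append [DecidableEq V] {u m v : V} {a : G.Walk u m} {b : G.Walk m v}
    (h : (a.append b).IsPath) (hm : m ∈ (a.append b).support) :
    ((a.append b).takeUntil m hm).edges = a.edges ∧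
      ((a.append b).dropUntil m hm).edges = b.edges := by
  have ha : ((a.append b).takeUntil m hm).edges = a.edges := by
    rw [Walk.takeUntil_append_of_mem_left a b a.end_mem_support]
    have hs := a.take_spec a.end_mem_support
    have hd : (a.dropUntil m a.end_mem_support).IsPath := h.of_append_left.dropUntil _
    rw [(Walk.isPath_iff_nil.1 hd).eq_nil, Walk.append_nil] at hs
    rw [hs]
  refine ⟨ha, ?_⟩
  have hs := congrArg Walk.edges ((a.append b).take_spec hm)
  rw [Walk.edges_append, Walk.edges_append, ha] at hs
  exact List.append_cancel_left hs

theorem isPath_append {u m v : V} {a : G.Walk u m} {b : G.Walk m v} (ha : a.IsPath)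
    (hb : b.IsPath) (h : ∀ x ∈ a.support, x ∈ b.support → x = m) : (a.append b).IsPath := by
  rw [Walk.isPath_def, Walk.support_append, List.nodup_append']
  refine ⟨ha.support_nodup, hb.support_nodup.sublist (List.tail_sublist _), ?_⟩
  intro x hx hx'
  have := h x hx (List.mem_of_mem_tail hx')
  subst this
  have hn := hb.support_nodup
  rw [← Walk.cons_tail_support] at hn
  exact (List.nodup_cons.1 hn).1 hx'

theorem eq_of_mem_of_isPath_append {u m v : V} {a : G.Walk u m} {b : G.Walk m v}
    (h : (a.append b).IsPath) {x : V} (hx : x ∈ a.support) (hx' : x ∈ b.support) : x = m := by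
  by_contra hne
  exact h.ne_of_mem_support_of_append hne hx hx' rfl

/-- A walk from a vertex with property `P` to a vertex without it leaves `P` along an edge: it
splits at the first such edge. -/
theorem exists_exit {P : V → Prop} {a t : V} (p : G.Walk a t) (ha : P a) (ht : ¬ P t) :
    ∃ (y x : V) (p₁ : G.Walk a y) (h : G.Adj y x) (p₂ : G.Walk x t),
      p = p₁.append (Walk.cons h p₂) ∧ (∀ z ∈ p₁.support, P z) ∧ ¬ P x := by
  induction p with
  | nil => exact absurd ha ht
  | @cons a b t h p ih =>
    by_cases hb : P b
    · obtain ⟨y, x, p₁, h', p₂, hp, hP, hx⟩ := ih hb ht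
      refine ⟨y, x, Walk.cons h p₁, h', p₂, by rw [hp]; rfl, ?_, hx⟩
      intro z hz
      rw [Walk.support_cons, List.mem_cons] at hz
      rcases hz with rfl | hz
      exacts [ha, hP z hz]
    · exact ⟨a, b, Walk.nil, h, p, rfl, by simpa using ha, hb⟩

/-- In a connected graph, two edges are joined by a path that contains exactly one
end of each of them. -/
theorem exists_path_between_edges (hG : G.Preconnected) {x y x' y' : V}
    (hne : x ≠ y) (hne' : x' ≠ y') :
    ∃ (a b a' b' : V) (Q : G.Walk a a'), Q.IsPath ∧ s(a, b) = s(x, y) ∧ s(a', b') = s(x', y') ∧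
      b ∉ Q.support ∧ b' ∉ Q.support := by
  classical
  obtain ⟨P, hP⟩ := (hG x x').exists_isPath
  obtain ⟨a', b', Q, hQ, hab', hb'⟩ : ∃ (a' b' : V) (Q : G.Walk x a'), Q.IsPath ∧
      s(a', b') = s(x', y') ∧ b' ∉ Q.support := by
    by_cases hy : y' ∈ P.support
    · exact ⟨y', x', P.takeUntil y' hy, hP.takeUntil hy, Sym2.eq_swap,
        Walk.endpoint_notMem_support_takeUntil hP hy hne'⟩
    · exact ⟨x', y', P, hP, rfl, hy⟩
  by_cases hy : y ∈ Q.support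
  · refine ⟨y, x, a', b', Q.dropUntil y hy, hQ.dropUntil hy, Sym2.eq_swap, hab', ?_,
      fun h => hb' (Q.support_dropUntil_subset_support hy h)⟩
    intro hx
    have h1 : ((Q.takeUntil y hy).append (Q.dropUntil y hy)).IsPath := by rwa [Q.take_spec hy]
    exact hne (eq_of_mem_of_isPath_append h1 (Walk.start_mem_support _) hx)
  · exact ⟨x, y, a', b', Q, hQ, rfl, hab', hy, hb'⟩

end Walks

/-! ### Forks and tangled paths -/

section Tangled

variable {V : Type*} [LinearOrder V] {G : SimpleGraph V}

theorem containsTangledPath_of_walks {m u v : V} {p : G.Walk m u} {q : G.Walk m v}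
    (hp : p.IsPath) (hq : q.IsPath) (hpq : ∀ x ∈ p.support, x ∈ q.support → x = m)
    (hm : (∀ x, x ∈ p.support ∨ x ∈ q.support → m ≤ x) ∨
      ∀ x, x ∈ p.support ∨ x ∈ q.support → x ≤ m)
    {e f : Sym2 V} (he : e ∈ p.edges) (hf : f ∈ q.edges) (hef : EdgesCross e f) :
    ContainsTangledPath G := by
  have hpath : (p.reverse.append q).IsPath :=
    isPath_append hp.reverse hq (by simpa using hpq)
  have hmem : m ∈ (p.reverse.append q).support := by simp
  have hedges := edges_takeUntil_append hpath hmem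
  refine ⟨u, v, p.reverse.append q, hpath, m, hmem, ?_, ?_, ?_, e, ?_, f, ?_, hef⟩
  · rintro rfl
    simp [(Walk.isPath_iff_nil.1 hp).eq_nil] at he
  · rintro rfl
    simp [(Walk.isPath_iff_nil.1 hq).eq_nil] at hf
  · simpa [Walk.mem_support_append_iff] using hm
  · rw [hedges.1]; simpa using he
  · rw [hedges.2]; exact hf

theorem containsTangledPath_iff (G : SimpleGraph V) :
    ContainsTangledPath G ↔ ∃ ℓ, HasFork ℓ G ∨ HasFork (V := Vᵒᵈ) ℓ G := by
  constructor
  · rintro ⟨u, v, W, hW, m, hm, -, -, hmin, e, he, f, hf, hef⟩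
    have hsplit : ((W.takeUntil m hm).append (W.dropUntil m hm)).IsPath := by
      rwa [W.take_spec hm]
    have h1 : ∀ x ∈ (W.takeUntil m hm).reverse.support, x ∈ W.support := fun x hx =>
      W.support_takeUntil_subset_support hm (by simpa using hx)
    have h2 : ∀ x ∈ (W.dropUntil m hm).support, x ∈ W.support := fun x hx =>
      W.support_dropUntil_subset_support hm hx
    have h3 : ∀ x ∈ (W.takeUntil m hm).reverse.support, x ∈ (W.dropUntil m hm).support → x = m :=
      fun x hx hx' => eq_of_mem_of_isPath_append hsplit (by simpa using hx) hx'
    have he' : e ∈ (W.takeUntil m hm).reverse.edges := by simpa using he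
    refine ⟨max (W.takeUntil m hm).reverse.length (W.dropUntil m hm).length, ?_⟩
    rcases hmin with hmin | hmin
    · exact Or.inl ⟨m, u, v, (W.takeUntil m hm).reverse, W.dropUntil m hm,
        hsplit.of_append_left.reverse, hsplit.of_append_right, le_max_left _ _, le_max_right _ _,
        h3, fun x hx => hmin x (h1 x hx), fun x hx => hmin x (h2 x hx), e, he', f,
        hf, hef⟩
    · exact Or.inr ⟨m, u, v, (W.takeUntil m hm).reverse, W.dropUntil m hm,
        hsplit.of_append_left.reverse, hsplit.of_append_right, le_max_left _ _, le_max_right _ _,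
        h3, fun x hx => hmin x (h1 x hx), fun x hx => hmin x (h2 x hx), e, he', f,
        hf, edgesCross_orderDual.2 hef⟩
  · rintro ⟨ℓ, ⟨m, u, v, p, q, hp, hq, -, -, hpq, h1, h2, e, he, f, hf, hef⟩ |
      ⟨m, u, v, p, q, hp, hq, -, -, hpq, h1, h2, e, he, f, hf, hef⟩⟩
    · exact containsTangledPath_of_walks hp hq hpq
        (Or.inl fun x hx => hx.elim (h1 x) (h2 x)) he hf hef
    · exact containsTangledPath_of_walks (V := V) hp hq hpq
        (Or.inr fun x hx => hx.elim (h1 x) (h2 x)) he hf (edgesCross_orderDual.1 hef)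

theorem hasFork_of_walks {m u v : V} {p : G.Walk m u} {q : G.Walk m v}
    (hp : p.IsPath) (hq : q.IsPath) (hpq : ∀ x ∈ p.support, x ∈ q.support → x = m)
    (hpm : ∀ x ∈ p.support, m ≤ x) (hqm : ∀ x ∈ q.support, m ≤ x)
    {e f : Sym2 V} (he : e ∈ p.edges) (hf : f ∈ q.edges) (hef : EdgesCross e f) :
    ∃ ℓ, HasFork ℓ G :=
  ⟨max p.length q.length, m, u, v, p, q, hp, hq, le_max_left _ _, le_max_right _ _, hpq, hpm, hqm,
    e, he, f, hf, hef⟩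

/-- A path through edges `x₀x₁` and `y₁y₀` at its two ends that cross each other, with its leftmost
vertex strictly between these ends, splits there into a fork. -/
theorem hasFork_of_extension {x₀ x₁ y₁ y₀ m : V} {Q : G.Walk x₁ y₁} (hQ : Q.IsPath)
    (hx : G.Adj x₁ x₀) (hy : G.Adj y₁ y₀) (hx₀ : x₀ ∉ Q.support) (hy₀ : y₀ ∉ Q.support)
    (hxy : x₀ ≠ y₀) (hm : m ∈ Q.support) (hmin : ∀ z ∈ Q.support, m ≤ z) (hmx : m ≤ x₀)
    (hmy : m ≤ y₀) (hcross : EdgesCross s(x₁, x₀) s(y₁, y₀)) : ∃ ℓ, HasFork ℓ G := by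
  obtain ⟨A, B, rfl⟩ := Walk.mem_support_iff_exists_append.1 hm
  simp only [Walk.mem_support_append_iff, not_or] at hx₀ hy₀ hmin
  refine hasFork_of_walks (p := A.reverse.concat hx) (q := B.concat hy) (e := s(x₁, x₀))
    (f := s(y₁, y₀)) ?_ ?_ ?_ ?_ ?_ ?_ ?_ hcross
  · exact hQ.of_append_left.reverse.concat (by simpa using hx₀.1) _
  · exact hQ.of_append_right.concat hy₀.2 _
  · intro z hz hz'
    simp only [Walk.support_concat, Walk.support_reverse, List.mem_append,
      List.mem_reverse, List.mem_singleton] at hz hz'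
    rcases hz with hz | rfl <;> rcases hz' with hz' | h
    · exact eq_of_mem_of_isPath_append hQ hz hz'
    · exact absurd (h ▸ hz) hy₀.1
    · exact absurd hz' hx₀.2
    · exact absurd h hxy
  · intro z hz
    simp only [Walk.support_concat, Walk.support_reverse, List.mem_append,
      List.mem_reverse, List.mem_singleton] at hz
    rcases hz with hz | rfl
    exacts [hmin z (Or.inl hz), hmx]
  · intro z hz
    simp only [Walk.support_concat, List.mem_append,
      List.mem_singleton] at hz
    rcases hz with hz | rfl
    exacts [hmin z (Or.inr hz), hmy]
  · simp [Walk.edges_concat]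
  · simp [Walk.edges_concat]

end Tangled

/-! ### Copies of ordered graphs -/

section Copies

variable {V W : Type*} [LinearOrder V] [LinearOrder W]

theorem edgesCross_map_iff {φ : V → W} (hφ : StrictMono φ) {e f : Sym2 V} :
    EdgesCross (e.map φ) (f.map φ) ↔ EdgesCross e f := by
  constructor
  · induction e with | h a b
    induction f with | h c d
    rintro ⟨u, v, u', v', h, h1, h2, h3⟩
    simp only [Sym2.map_mk] at h
    have key : ∀ {a b c d : V}, s(φ a, φ b) = s(u, v) → s(φ c, φ d) = s(u', v') →
        EdgesCross s(a, b) s(c, d) := by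
      intro a b c d hab hcd
      rw [Sym2.eq_iff] at hab hcd
      rcases hab with ⟨rfl, rfl⟩ | ⟨rfl, rfl⟩ <;> rcases hcd with ⟨rfl, rfl⟩ | ⟨rfl, rfl⟩ <;>
        simp only [hφ.lt_iff_lt] at h1 h2 h3
      · exact ⟨a, b, c, d, Or.inl ⟨rfl, rfl⟩, h1, h2, h3⟩
      · exact ⟨a, b, d, c, Or.inl ⟨rfl, Sym2.eq_swap⟩, h1, h2, h3⟩
      · exact ⟨b, a, c, d, Or.inl ⟨Sym2.eq_swap, rfl⟩, h1, h2, h3⟩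
      · exact ⟨b, a, d, c, Or.inl ⟨Sym2.eq_swap, Sym2.eq_swap⟩, h1, h2, h3⟩
    rcases h with ⟨h, h'⟩ | ⟨h, h'⟩
    · exact key h h'
    · exact (key h h').symm
  · rintro ⟨u, v, u', v', h, h1, h2, h3⟩
    refine ⟨φ u, φ v, φ u', φ v', ?_, hφ h1, hφ h2, hφ h3⟩
    rcases h with ⟨rfl, rfl⟩ | ⟨rfl, rfl⟩
    · exact Or.inl ⟨rfl, rfl⟩
    · exact Or.inr ⟨rfl, rfl⟩

theorem HasFork.of_copy {H : SimpleGraph V} {G : SimpleGraph W} {ℓ : ℕ} (h : HasFork ℓ H)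
    (hc : ContainsCopy H G) : HasFork ℓ G := by
  obtain ⟨φ, hφ⟩ := hc
  obtain ⟨m, u, v, p, q, hp, hq, hpl, hql, hpq, hpm, hqm, e, he, f, hf, hef⟩ := h
  refine ⟨φ m, φ u, φ v, p.map φ, q.map φ, (Walk.isPath_map_iff_of_injective hφ.injective).2 hp,
    (Walk.isPath_map_iff_of_injective hφ.injective).2 hq, by simpa, by simpa, ?_, ?_, ?_,
    e.map φ, ?_, f.map φ, ?_, (edgesCross_map_iff hφ).2 hef⟩
  · intro x hx hx'
    simp only [Walk.support_map, List.mem_map] at hx hx'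
    obtain ⟨a, ha, rfl⟩ := hx
    obtain ⟨b, hb, hab⟩ := hx'
    rw [hφ.injective hab] at hb
    rw [hpq a ha hb]
  · intro x hx
    simp only [Walk.support_map, List.mem_map] at hx
    obtain ⟨a, ha, rfl⟩ := hx
    exact hφ.monotone (hpm a ha)
  · intro x hx
    simp only [Walk.support_map, List.mem_map] at hx
    obtain ⟨a, ha, rfl⟩ := hx
    exact hφ.monotone (hqm a ha)
  · rw [Walk.edges_map]; exact List.mem_map_of_mem he
  · rw [Walk.edges_map]; exact List.mem_map_of_mem hf

theorem HasLeftBonnet.of_copy {H : SimpleGraph V} {G : SimpleGraph W} (h : HasLeftBonnet H)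
    (hc : ContainsCopy H G) : HasLeftBonnet G := by
  obtain ⟨φ, hφ⟩ := hc
  obtain ⟨u₁, u₂, u₃, u₄, u₅, h1, h2, h3, h4, h5, h6, h7, h8⟩ := h
  exact ⟨φ u₁, φ u₂, φ u₃, φ u₄, φ u₅, hφ h1, hφ.monotone h2, hφ h3, hφ.monotone h4,
    fun h => h5 ⟨hφ.injective h.1, hφ.injective h.2⟩, φ.map_adj h6, φ.map_adj h7, φ.map_adj h8⟩

end Copies

/-! ### Star joins -/

section StarJoin

variable {V D : Type*} {κ : ℕ}

/-- The center of a star. -/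
def starCenter (κ : ℕ) (V : Type*) (d : D) : D ⊕ₗ (Fin κ ×ₗ V) := toLex (Sum.inl d)

/-- The vertex `v` of the `j`-th copy. -/
def starCopy (D : Type*) (j : Fin κ) (v : V) : D ⊕ₗ (Fin κ ×ₗ V) := toLex (Sum.inr (toLex (j, v)))

/-- The star join of a graph `X`: consecutive disjoint copies of `X`, one for each `j : Fin κ`, and,
to the left of all of them, a set `D` of new vertices. The new vertex `d` has one neighbor in each
copy, which is the vertex `g d j` in the `j`-th copy. -/
def starJoin (X : SimpleGraph V) (g : D → Fin κ → V) : SimpleGraph (D ⊕ₗ (Fin κ ×ₗ V)) where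
  Adj x y := match ofLex x, ofLex y with
    | Sum.inl _, Sum.inl _ => False
    | Sum.inl d, Sum.inr p => (ofLex p).2 = g d (ofLex p).1
    | Sum.inr p, Sum.inl d => (ofLex p).2 = g d (ofLex p).1
    | Sum.inr p, Sum.inr p' => (ofLex p).1 = (ofLex p').1 ∧ X.Adj (ofLex p).2 (ofLex p').2
  symm := ⟨by
    intro x y h
    rcases hx : ofLex x with d | p <;> rcases hy : ofLex y with d' | p' <;>
      simp only [hx, hy] at h ⊢
    · exact h
    · exact h
    · exact ⟨h.1.symm, h.2.symm⟩⟩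
  loopless := ⟨by
    intro x h
    rcases hx : ofLex x with d | p <;> simp only [hx] at h
    exact h.2.ne rfl⟩

variable (X : SimpleGraph V) (g : D → Fin κ → V)

theorem star_cases (x : D ⊕ₗ (Fin κ ×ₗ V)) :
    (∃ d, x = starCenter κ V d) ∨ ∃ j v, x = starCopy D j v := by
  rcases hx : ofLex x with d | p
  · exact Or.inl ⟨d, hx⟩
  · exact Or.inr ⟨(ofLex p).1, (ofLex p).2, hx⟩

theorem starJoin_adj_center_center (d d' : D) :
    ¬ (starJoin X g).Adj (starCenter κ V d) (starCenter κ V d') := id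

theorem starJoin_adj_center_copy (d : D) (j : Fin κ) (v : V) :
    (starJoin X g).Adj (starCenter κ V d) (starCopy D j v) ↔ v = g d j := Iff.rfl

theorem starJoin_adj_copy_center (d : D) (j : Fin κ) (v : V) :
    (starJoin X g).Adj (starCopy D j v) (starCenter κ V d) ↔ v = g d j := Iff.rfl

theorem starJoin_adj_copy_copy (j j' : Fin κ) (v v' : V) :
    (starJoin X g).Adj (starCopy D j v) (starCopy D j' v') ↔ j = j' ∧ X.Adj v v' := Iff.rfl

theorem starCopy_inj {j j' : Fin κ} {v v' : V} :
    starCopy D j v = starCopy D j' v' ↔ j = j' ∧ v = v' := by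
  constructor
  · intro h
    have := Sum.inr_injective (toLex.injective h)
    exact Prod.ext_iff.1 (toLex.injective this)
  · rintro ⟨rfl, rfl⟩
    rfl

theorem starCenter_ne_starCopy (d : D) (j : Fin κ) (v : V) :
    starCenter κ V d ≠ starCopy D j v :=
  fun h => Sum.inl_ne_inr (toLex.injective h)

variable {X g}

/-- A walk that starts in a copy either arrives at a center, after a walk in this copy, or stays
in the copy. -/
theorem starJoin_walk {x y : D ⊕ₗ (Fin κ ×ₗ V)} (p : (starJoin X g).Walk x y) :
    ∀ (j : Fin κ) (v : V), x = starCopy D j v →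
      (∃ (d : D) (w : X.Walk v (g d j)), w.length < p.length ∧ starCenter κ V d ∈ p.support) ∨
      ∃ (y' : V) (w : X.Walk v y'), y = starCopy D j y' ∧
        p.support = w.support.map (starCopy D j) ∧
        p.edges = w.edges.map (Sym2.map (starCopy D j)) := by
  induction p with
  | nil =>
    rintro j v rfl
    exact Or.inr ⟨v, Walk.nil, rfl, rfl, rfl⟩
  | @cons x z y h p ih =>
    rintro j v rfl
    rcases star_cases z with ⟨d, rfl⟩ | ⟨j', v', rfl⟩
    · rw [starJoin_adj_copy_center] at h
      subst h
      exact Or.inl ⟨d, Walk.nil, by simp, by simp⟩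
    · have h' := h
      rw [starJoin_adj_copy_copy] at h'
      obtain ⟨rfl, hv⟩ := h'
      rcases ih j v' rfl with ⟨d, w, hw, hd⟩ | ⟨y', w, hy, hs, he⟩
      · exact Or.inl ⟨d, Walk.cons hv w, by simpa using hw, by simp [hd]⟩
      · exact Or.inr ⟨y', Walk.cons hv w, hy, by simp [hs], by simp [he]⟩

end StarJoin

section StarJoinOrder

variable {V D : Type*} [LinearOrder V] [LinearOrder D] {κ : ℕ} {X : SimpleGraph V}
  {g : D → Fin κ → V}

theorem starCopy_strictMono (j : Fin κ) : StrictMono (starCopy (V := V) D j) := by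
  intro a b h
  exact Sum.Lex.inr_lt_inr_iff.2 (Prod.Lex.toLex_lt_toLex.2 (Or.inr ⟨rfl, h⟩))

theorem starCenter_lt_starCopy (d : D) (j : Fin κ) (v : V) :
    starCenter κ V d < starCopy D j v := Sum.Lex.inl_lt_inr _ _

theorem le_of_starCopy_lt {j j' : Fin κ} {v v' : V} (h : starCopy D j v < starCopy D j' v') :
    j ≤ j' := by
  have := Prod.Lex.toLex_lt_toLex.1 (Sum.Lex.inr_lt_inr_iff.1 h)
  rcases this with h | h
  exacts [h.le, h.1.le]

/-- If, in each copy, the neighbors of distinct centers are more than `ℓ` apart, then the star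
join has no fork within `ℓ` unless `X` has one. The centers are to the left of all copies, so
a fork starts in a copy, where it stays, or it starts at a center and its two paths stay in two
different copies. -/
theorem not_hasFork_starJoin {ℓ : ℕ} (hX : ¬ HasFork ℓ X)
    (hfar : ∀ d d' j, d ≠ d' → ∀ w : X.Walk (g d j) (g d' j), ℓ < w.length) :
    ¬ HasFork ℓ (starJoin X g) := by
  rintro ⟨m, u, v, p, q, hp, hq, hpl, hql, hpq, hpm, hqm, e, he, f, hf, hef⟩
  rcases star_cases m with ⟨d, rfl⟩ | ⟨j, a, rfl⟩
  · have leg : ∀ {t} (r : (starJoin X g).Walk (starCenter κ V d) t), r.IsPath → r.length ≤ ℓ →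
        ∀ e ∈ r.edges, ∃ j, starCopy D j (g d j) ∈ r.support ∧
          ∀ x ∈ r.support, x = starCenter κ V d ∨ ∃ b, x = starCopy D j b := by
      intro t r hr hl e he
      cases r with
      | nil => simp at he
      | @cons _ z _ h r =>
        rcases star_cases z with ⟨d', rfl⟩ | ⟨j, b, rfl⟩
        · exact absurd h (starJoin_adj_center_center X g d d')
        · have hb := h
          rw [starJoin_adj_center_copy] at hb
          subst hb
          rw [Walk.cons_isPath_iff] at hr
          rw [Walk.length_cons] at hl
          rcases starJoin_walk r j _ rfl with ⟨d', w, hw, hd⟩ | ⟨y', w, rfl, hs, -⟩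
          · have := hfar d d' j (fun h => hr.2 (h ▸ hd)) w
            omega
          · refine ⟨j, by simp, fun x hx => ?_⟩
            rw [Walk.support_cons, List.mem_cons, hs, List.mem_map] at hx
            rcases hx with rfl | ⟨b, -, rfl⟩
            exacts [Or.inl rfl, Or.inr ⟨b, rfl⟩]
    obtain ⟨j, hj, hj'⟩ := leg p hp hpl e he
    obtain ⟨k, hk, hk'⟩ := leg q hq hql f hf
    have hjk : j ≠ k := by
      rintro rfl
      exact starCenter_ne_starCopy _ _ _ (hpq _ hj hk).symm
    have key : ∀ {j k : Fin κ}, j ≠ k → ∀ {u v u' v' : D ⊕ₗ (Fin κ ×ₗ V)},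
        (u = starCenter κ V d ∨ ∃ b, u = starCopy D j b) →
        (v = starCenter κ V d ∨ ∃ b, v = starCopy D j b) →
        (u' = starCenter κ V d ∨ ∃ b, u' = starCopy D k b) →
        (v' = starCenter κ V d ∨ ∃ b, v' = starCopy D k b) →
        u < u' → u' < v → v < v' → False := by
      intro j k hjk u v u' v' hu hv hu' hv' h1 h2 h3
      have hmin : starCenter κ V d ≤ u := by
        rcases hu with rfl | ⟨b, rfl⟩
        exacts [le_rfl, (starCenter_lt_starCopy _ _ _).le]
      obtain ⟨b, rfl⟩ := hu'.resolve_left (hmin.trans_lt h1).ne'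
      obtain ⟨c, rfl⟩ := hv.resolve_left ((hmin.trans_lt h1).trans h2).ne'
      obtain ⟨b', rfl⟩ := hv'.resolve_left (((hmin.trans_lt h1).trans h2).trans h3).ne'
      exact hjk (le_antisymm (le_of_starCopy_lt h3) (le_of_starCopy_lt h2))
    obtain ⟨a, b, a', b', h | h, h1, h2, h3⟩ := hef
    · obtain ⟨rfl, rfl⟩ := h
      exact key hjk (hj' _ (p.fst_mem_support_of_mem_edges he))
        (hj' _ (p.snd_mem_support_of_mem_edges he)) (hk' _ (q.fst_mem_support_of_mem_edges hf))
        (hk' _ (q.snd_mem_support_of_mem_edges hf)) h1 h2 h3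
    · obtain ⟨rfl, rfl⟩ := h
      exact key hjk.symm (hk' _ (q.fst_mem_support_of_mem_edges hf))
        (hk' _ (q.snd_mem_support_of_mem_edges hf)) (hj' _ (p.fst_mem_support_of_mem_edges he))
        (hj' _ (p.snd_mem_support_of_mem_edges he)) h1 h2 h3
  · have leg : ∀ {t} (r : (starJoin X g).Walk (starCopy D j a) t), r.IsPath →
        (∀ x ∈ r.support, starCopy D j a ≤ x) → ∃ (b : V) (w : X.Walk a b), w.IsPath ∧
          w.length = r.length ∧ r.support = w.support.map (starCopy D j) ∧
          r.edges = w.edges.map (Sym2.map (starCopy D j)) := by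
      intro t r hr hm
      rcases starJoin_walk r j a rfl with ⟨d, -, -, hd⟩ | ⟨b, w, rfl, hs, hedges⟩
      · exact absurd (hm _ hd) (starCenter_lt_starCopy _ _ _).not_ge
      · refine ⟨b, w, ?_, ?_, hs, hedges⟩
        · rw [Walk.isPath_def, hs] at hr
          exact (Walk.isPath_def _).2 hr.of_map
        · rw [← Walk.length_edges, ← Walk.length_edges, hedges, List.length_map]
    obtain ⟨b, w, hw, hwl, hws, hwe⟩ := leg p hp hpm
    obtain ⟨c, z, hz, hzl, hzs, hze⟩ := leg q hq hqm
    rw [hwe, List.mem_map] at he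
    rw [hze, List.mem_map] at hf
    obtain ⟨e, he, rfl⟩ := he
    obtain ⟨f, hf, rfl⟩ := hf
    have hmono := starCopy_strictMono (V := V) (D := D) j
    refine hX ⟨a, b, c, w, z, hw, hz, by omega, by omega, ?_, ?_, ?_, e, he, f, hf,
      (edgesCross_map_iff hmono).1 hef⟩
    · intro x hx hx'
      refine hmono.injective (hpq _ ?_ ?_)
      · rw [hws]; exact List.mem_map_of_mem hx
      · rw [hzs]; exact List.mem_map_of_mem hx'
    · intro x hx
      refine hmono.le_iff_le.1 (hpm _ ?_)
      rw [hws]; exact List.mem_map_of_mem hx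
    · intro x hx
      refine hmono.le_iff_le.1 (hqm _ ?_)
      rw [hzs]; exact List.mem_map_of_mem hx

end StarJoinOrder

/-! ### Sparse subsets and balls in graphs of bounded degree -/

section Finite

/-- A symmetric relation in which every element is related to at most `K` elements admits, inside
every finite set `A`, a subset of unrelated elements with at least `|A| / K` elements. -/
theorem exists_pairwise_not_rel {B : Type*} [Fintype B] (r : B → B → Prop) (hr : ∀ b, r b b)
    (hs : ∀ b b', r b b' → r b' b) {K : ℕ} (hK : ∀ b, {b' | r b b'}.ncard ≤ K) (A : Finset B) :
    ∃ S ⊆ A, (∀ b ∈ S, ∀ b' ∈ S, b ≠ b' → ¬ r b b') ∧ A.card ≤ S.card * K := by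
  classical
  induction h : A.card using Nat.strong_induction_on generalizing A with
  | _ n ih =>
    subst h
    rcases A.eq_empty_or_nonempty with rfl | ⟨a, ha⟩
    · exact ⟨∅, by simp⟩
    · have hlt : (A.filter fun b => ¬ r a b).card < A.card :=
        Finset.card_lt_card (Finset.filter_ssubset.2 ⟨a, ha, by simpa using hr a⟩)
      obtain ⟨S, hSA, hS, hcard⟩ := ih _ hlt _ rfl
      have haS : a ∉ S := fun h => (Finset.mem_filter.1 (hSA h)).2 (hr a)
      refine ⟨insert a S, ?_, ?_, ?_⟩
      · intro b hb
        rcases Finset.mem_insert.1 hb with rfl | hb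
        exacts [ha, (Finset.mem_filter.1 (hSA hb)).1]
      · intro b hb b' hb' hne
        rcases Finset.mem_insert.1 hb with hba | hbS <;>
          rcases Finset.mem_insert.1 hb' with hba' | hbS'
        · exact absurd (hba.trans hba'.symm) hne
        · exact hba ▸ (Finset.mem_filter.1 (hSA hbS')).2
        · exact fun h => (Finset.mem_filter.1 (hSA hbS)).2 (hs _ _ (hba' ▸ h))
        · exact hS b hbS b' hbS' hne
      · have h1 := Finset.card_filter_add_card_filter_not (s := A) (fun b => r a b)
        have h2 : (A.filter fun b => r a b).card ≤ K := by
          refine le_trans ?_ (hK a)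
          rw [← Set.ncard_coe_finset]
          exact Set.ncard_le_ncard (by intro b; simp) (Set.toFinite _)
        rw [Finset.card_insert_of_notMem haS, add_mul, one_mul]
        omega

/-- The number of vertices within distance `n` of a vertex, in terms of the maximum degree. -/
theorem ncard_ball_le {V : Type*} [Finite V] {X : SimpleGraph V} {Δ : ℕ}
    (hΔ : ∀ v, (X.neighborSet v).ncard ≤ Δ) (n : ℕ) (v : V) :
    {v' | ∃ w : X.Walk v v', w.length ≤ n}.ncard ≤ (Δ + 1) ^ n := by
  classical
  induction n generalizing v with
  | zero =>
    rw [pow_zero, Set.ncard_le_one_iff]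
    rintro a b ⟨w, hw⟩ ⟨w', hw'⟩
    have h1 := Walk.eq_of_length_eq_zero (Nat.le_zero.1 hw)
    have h2 := Walk.eq_of_length_eq_zero (Nat.le_zero.1 hw')
    rw [← h1, ← h2]
  | succ n ih =>
    have : Fintype V := Fintype.ofFinite V
    set N : Finset V := (insert v (X.neighborSet v)).toFinite.toFinset with hN
    have hNc : N.card ≤ Δ + 1 := by
      rw [hN, ← Set.ncard_eq_toFinset_card]
      exact (Set.ncard_insert_le _ _).trans (by have := hΔ v; omega)
    have hsub : {v' | ∃ w : X.Walk v v', w.length ≤ n + 1} ⊆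
        ↑(N.biUnion fun z => {v' | ∃ w : X.Walk z v', w.length ≤ n}.toFinite.toFinset) := by
      rintro v' ⟨w, hw⟩
      simp only [hN, Finset.coe_biUnion, Set.Finite.coe_toFinset, Set.mem_iUnion]
      cases w with
      | nil => exact ⟨v, Set.mem_insert _ _, Walk.nil, by simp⟩
      | @cons _ z _ h w =>
        exact ⟨z, Set.mem_insert_of_mem _ h, w, by rw [Walk.length_cons] at hw; omega⟩
    refine (Set.ncard_le_ncard hsub (Set.toFinite _)).trans ?_
    rw [Set.ncard_coe_finset]
    refine (Finset.card_biUnion_le_card_mul _ _ ((Δ + 1) ^ n) fun z _ => ?_).trans ?_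
    · rw [← Set.ncard_eq_toFinset_card]
      exact ih z
    · rw [pow_succ, mul_comm]
      exact Nat.mul_le_mul_left _ hNc

end Finite

/-! ### Block systems -/

/-- A finite ordered graph `X` without forks whose legs have length at most `ℓ`, together with
pairwise disjoint blocks in it. A block is given by a homomorphism from `G`, whose injectivity is
never needed. The number `use b` counts the stars centered outside the block `b` that have been
attached to it: a vertex of `b` has at most `use b` neighbors in addition to `|W|`, and a vertex
outside the blocks has at most `κ` neighbors. -/
structure BlockSystem {W : Type} (G : SimpleGraph W) (κ ℓ : ℕ) where
  V : Type
  [ord : LinearOrder V]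
  [fin : Finite V]
  X : SimpleGraph V
  B : Type
  [finB : Fintype B]
  emb : B → W → V
  use : B → ℕ
  adj_emb : ∀ (b : B) {w w' : W}, G.Adj w w' → X.Adj (emb b w) (emb b w')
  block_unique : ∀ {b b' : B} {w w' : W}, emb b w = emb b' w' → b = b'
  no_fork : ¬ HasFork ℓ X
  degree_block : ∀ b w, (X.neighborSet (emb b w)).ncard ≤ Nat.card W + use b
  degree_center : ∀ v, (∀ b w, v ≠ emb b w) → (X.neighborSet v).ncard ≤ κ

namespace BlockSystem

attribute [instance] BlockSystem.ord BlockSystem.fin BlockSystem.finB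

variable {W : Type} {G : SimpleGraph W} {κ ℓ : ℕ}

/-- The colorings of the blocks that extend to proper colorings of the whole graph. -/
def colorings (S : BlockSystem G κ ℓ) : Set (S.B → W → Fin κ) :=
  {c | ∃ C : S.X.Coloring (Fin κ), ∀ b w, c b w = C (S.emb b w)}

/-- Two blocks are near if they are joined by a walk of length at most `ℓ`. -/
def Near (S : BlockSystem G κ ℓ) (b b' : S.B) : Prop :=
  ∃ (w w' : W) (p : S.X.Walk (S.emb b w) (S.emb b' w')), p.length ≤ ℓ

theorem Near.symm {S : BlockSystem G κ ℓ} {b b' : S.B} (h : S.Near b b') : S.Near b' b := by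
  obtain ⟨w, w', p, hp⟩ := h
  exact ⟨w', w, p.reverse, by simpa using hp⟩

theorem ncard_near_le [Finite W] (S : BlockSystem G κ ℓ) {D : ℕ} (hD : ∀ b, S.use b ≤ D) (b : S.B) :
    {b' | S.Near b b'}.ncard ≤ Nat.card W * (Nat.card W + D + κ + 1) ^ ℓ := by
  classical
  have : Fintype W := Fintype.ofFinite W
  have hdeg : ∀ v, (S.X.neighborSet v).ncard ≤ Nat.card W + D + κ := by
    intro v
    by_cases hv : ∃ b w, v = S.emb b w
    · obtain ⟨b, w, rfl⟩ := hv
      have := S.degree_block b w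
      have := hD b
      omega
    · push Not at hv
      have := S.degree_center v hv
      omega
  set U : Finset S.V := Finset.univ.biUnion fun w : W =>
    {v' | ∃ p : S.X.Walk (S.emb b w) v', p.length ≤ ℓ}.toFinite.toFinset with hU
  have hUc : U.card ≤ Nat.card W * (Nat.card W + D + κ + 1) ^ ℓ := by
    rw [Nat.card_eq_fintype_card]
    refine Finset.card_biUnion_le_card_mul _ _ _ fun w _ => ?_
    rw [← Set.ncard_eq_toFinset_card, ← Nat.card_eq_fintype_card]
    exact ncard_ball_le hdeg ℓ _
  refine le_trans ?_ hUc
  rw [← Set.ncard_coe_finset]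
  have hch : ∀ b' : S.B, S.Near b b' → ∃ v, v ∈ U ∧ ∃ w', v = S.emb b' w' := by
    rintro b' ⟨w, w', p, hp⟩
    exact ⟨S.emb b' w', by simpa [hU] using ⟨w, p, hp⟩, w', rfl⟩
  rcases isEmpty_or_nonempty S.V with hV | hV
  · have : {b' | S.Near b b'} = ∅ :=
      Set.eq_empty_of_forall_notMem fun b' ⟨w, _⟩ => hV.elim (S.emb b w)
    simp [this]
  choose! f hf using hch
  refine Set.ncard_le_ncard_of_injOn f (fun b' hb' => (hf b' hb').1) ?_ (Set.toFinite _)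
  intro b₁ h₁ b₂ h₂ h
  obtain ⟨-, w₁, e₁⟩ := hf b₁ h₁
  obtain ⟨-, w₂, e₂⟩ := hf b₂ h₂
  exact S.block_unique (e₁.symm.trans (h.trans e₂))

end BlockSystem

/-! ### Extending block systems -/

namespace BlockSystem

variable {W : Type} {G : SimpleGraph W} {κ ℓ : ℕ}

open Classical in
/-- The star join of a block system with one star for each block in `T`, where `T` consists of
blocks no two of which are near: `s d j` is the position, inside its block in the `j`-th copy, of
the neighbor of the center of the star number `d`. -/
noncomputable def extend [Finite W] (S : BlockSystem G κ ℓ) (T : Finset S.B)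
    (hT : ∀ b ∈ T, ∀ b' ∈ T, b ≠ b' → ¬ S.Near b b') (s : Fin T.card → Fin κ → W) :
    BlockSystem G κ ℓ where
  V := Fin T.card ⊕ₗ (Fin κ ×ₗ S.V)
  X := starJoin S.X fun d j => S.emb (T.equivFin.symm d) (s d j)
  B := Fin κ × S.B
  emb b w := starCopy _ b.1 (S.emb b.2 w)
  use b := S.use b.2 + if b.2 ∈ T then 1 else 0
  adj_emb b _ _ h := (starJoin_adj_copy_copy _ _ _ _ _ _).2 ⟨rfl, S.adj_emb b.2 h⟩
  block_unique h := by
    rw [starCopy_inj] at h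
    exact Prod.ext h.1 (S.block_unique h.2)
  fin := inferInstanceAs (Finite (Fin T.card ⊕ (Fin κ × S.V)))
  no_fork := by
    refine not_hasFork_starJoin S.no_fork fun d d' j hd w => ?_
    by_contra hw
    refine hT _ (T.equivFin.symm d).2 _ (T.equivFin.symm d').2 ?_ ⟨_, _, w, not_lt.1 hw⟩
    exact fun h => hd (T.equivFin.symm.injective (Subtype.ext h))
  degree_block := by
    rintro ⟨j, b⟩ w
    have hfin : Finite (Fin T.card ⊕ₗ (Fin κ ×ₗ S.V)) :=
      inferInstanceAs (Finite (Fin T.card ⊕ (Fin κ × S.V)))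
    have hsub : (starJoin S.X fun d j => S.emb (T.equivFin.symm d) (s d j)).neighborSet
        (starCopy _ j (S.emb b w)) ⊆ starCopy _ j '' S.X.neighborSet (S.emb b w) ∪
          starCenter κ S.V '' {d | (T.equivFin.symm d : S.B) = b} := by
      intro x hx
      rw [mem_neighborSet] at hx
      rcases star_cases x with ⟨d, rfl⟩ | ⟨j', v, rfl⟩
      · rw [starJoin_adj_copy_center] at hx
        exact Or.inr ⟨d, (S.block_unique hx).symm, rfl⟩
      · rw [starJoin_adj_copy_copy] at hx
        obtain ⟨rfl, hx⟩ := hx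
        exact Or.inl ⟨v, hx, rfl⟩
    have hone : {d : Fin T.card | (T.equivFin.symm d : S.B) = b}.ncard ≤
        if b ∈ T then 1 else 0 := by
      split_ifs with hb
      · rw [Set.ncard_le_one_iff]
        intro d d' hd hd'
        exact T.equivFin.symm.injective (Subtype.ext (Eq.trans hd (Eq.symm hd')))
      · rw [Nat.le_zero, Set.ncard_eq_zero]
        exact Set.eq_empty_of_forall_notMem fun d hd => hb (hd ▸ (T.equivFin.symm d).2)
    have h1 := Set.ncard_le_ncard hsub (Set.toFinite _)
    have h2 := Set.ncard_union_le (starCopy (Fin T.card) j '' S.X.neighborSet (S.emb b w))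
      (starCenter κ S.V '' {d | (T.equivFin.symm d : S.B) = b})
    have h3 := Set.ncard_image_le (f := starCopy (Fin T.card) j)
      (Set.toFinite (S.X.neighborSet (S.emb b w)))
    have h4 := Set.ncard_image_le (f := starCenter κ S.V)
      (Set.toFinite {d : Fin T.card | (T.equivFin.symm d : S.B) = b})
    have h5 := S.degree_block b w
    simp only
    omega
  degree_center := by
    intro v hv
    rcases star_cases v with ⟨d, rfl⟩ | ⟨j, v, rfl⟩
    · refine le_trans (Set.ncard_le_ncard (t := Set.range fun j =>
        starCopy (Fin T.card) j (S.emb (T.equivFin.symm d) (s d j))) ?_ (Set.toFinite _)) ?_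
      · intro x hx
        rw [mem_neighborSet] at hx
        rcases star_cases x with ⟨d', rfl⟩ | ⟨j', v, rfl⟩
        · exact absurd hx (starJoin_adj_center_center _ _ d d')
        · rw [starJoin_adj_center_copy] at hx
          exact ⟨j', by rw [hx]⟩
      · rw [← Set.image_univ]
        refine (Set.ncard_image_le (Set.toFinite _)).trans ?_
        simp
    · refine le_trans (Set.ncard_le_ncard
        (t := starCopy (Fin T.card) j '' S.X.neighborSet v) ?_ (Set.toFinite _)) ?_
      · intro x hx
        rw [mem_neighborSet] at hx
        rcases star_cases x with ⟨d, rfl⟩ | ⟨j', v', rfl⟩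
        · rw [starJoin_adj_copy_center] at hx
          exact absurd (by rw [hx]) (hv (j, T.equivFin.symm d) (s d j))
        · rw [starJoin_adj_copy_copy] at hx
          obtain ⟨rfl, hx⟩ := hx
          exact ⟨v', hx, rfl⟩
      · refine (Set.ncard_image_le (Set.toFinite _)).trans (S.degree_center v fun b w h => ?_)
        exact hv (j, b) w (by rw [h])

/-- If `G` is not `k`-colorable then all `k + 1` colors appear in each block. -/
theorem surjective_of_mem_colorings {k : ℕ} (hG : ¬ G.Colorable k) {S : BlockSystem G (k + 1) ℓ}
    {c : S.B → W → Fin (k + 1)} (hc : c ∈ S.colorings) (b : S.B) : Function.Surjective (c b) := by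
  obtain ⟨C, hC⟩ := hc
  by_contra hns
  rw [Function.Surjective] at hns
  push Not at hns
  obtain ⟨i, hi⟩ := hns
  apply hG
  let C' : G.Coloring {x : Fin (k + 1) // x ≠ i} := Coloring.mk (fun w => ⟨c b w, hi w⟩) (by
    intro w w' h h'
    have := congrArg Subtype.val h'
    simp only [hC] at this
    exact C.valid (S.adj_emb b h) this)
  have := C'.colorable
  simpa using this

/-- The positions of the stars in a star join can be chosen so that a constant proportion of the
combinations of colorings of the copies is excluded at each star: a star excludes a combination if
its center sees all colors, and some choice of positions achieves this. The bound holds on average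
over all choices. -/
theorem exists_extend [Finite W] {k : ℕ} (hG : ¬ G.Colorable k) (S : BlockSystem G (k + 1) ℓ)
    (T : Finset S.B) (hT : ∀ b ∈ T, ∀ b' ∈ T, b ≠ b' → ¬ S.Near b b') :
    ∃ s, (S.extend T hT s).colorings.ncard * (Nat.card W ^ (k + 1)) ^ T.card ≤
      S.colorings.ncard ^ (k + 1) * (Nat.card W ^ (k + 1) - 1) ^ T.card := by
  classical
  have : Fintype W := Fintype.ofFinite W
  rw [Nat.card_eq_fintype_card]
  set n := T.card with hn
  set M := Fintype.card W with hM
  have hcol : Finite (S.B → W → Fin (k + 1)) := inferInstance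
  let 𝒞 := {c : S.B → W → Fin (k + 1) // c ∈ S.colorings}
  have : Fintype 𝒞 := Fintype.ofFinite _
  let β : Fin n → S.B := fun d => (T.equivFin.symm d : S.B)
  let bad : (Fin (k + 1) → 𝒞) → Fin n → (Fin (k + 1) → W) → Prop := fun c d t =>
    ¬ Function.Surjective fun j => (c j).1 (β d) (t j)
  have hbad : ∀ c d, (Finset.univ.filter fun t => bad c d t).card ≤ M ^ (k + 1) - 1 := by
    intro c d
    have hlt : (Finset.univ.filter fun t => bad c d t).card <
        (Finset.univ : Finset (Fin (k + 1) → W)).card := by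
      refine Finset.card_lt_card (Finset.filter_ssubset.2 ?_)
      choose t ht using fun j => surjective_of_mem_colorings hG (c j).2 (β d) j
      exact ⟨t, Finset.mem_univ _, not_not.2 fun j => ⟨j, ht j⟩⟩
    rw [Finset.card_univ, Fintype.card_fun, Fintype.card_fin] at hlt
    exact Nat.le_sub_one_of_lt hlt
  let f : (Fin n → Fin (k + 1) → W) → ℕ := fun s =>
    (Finset.univ.filter fun c : Fin (k + 1) → 𝒞 => ∀ d, bad c d (s d)).card
  have hf : ∀ s, (S.extend T hT s).colorings.ncard ≤ f s := by
    intro s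
    have hcopy : ∀ (j : Fin (k + 1)) {v v' : S.V}, S.X.Adj v v' → (S.extend T hT s).X.Adj
        (starCopy (Fin T.card) j v) (starCopy (Fin T.card) j v') := fun j v v' h =>
      (starJoin_adj_copy_copy S.X (fun d j => S.emb (β d) (s d j)) j j v v').2 ⟨rfl, h⟩
    have hcenter : ∀ (d : Fin T.card) (j : Fin (k + 1)), (S.extend T hT s).X.Adj
        (starCenter (k + 1) S.V d) (starCopy (Fin T.card) j (S.emb (β d) (s d j))) := fun d j =>
      (starJoin_adj_center_copy S.X (fun d j => S.emb (β d) (s d j)) d j _).2 rfl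
    have hres : ∀ c ∈ (S.extend T hT s).colorings, ∀ j,
        (fun b w => c ((j, b) : Fin (k + 1) × S.B) w) ∈ S.colorings := by
      rintro c ⟨C, hC⟩ j
      refine ⟨Coloring.mk (fun v => C (starCopy (Fin T.card) j v)) ?_, fun b w => hC (j, b) w⟩
      intro v v' h
      exact C.valid (hcopy j h)
    have hF : ∀ c : (S.extend T hT s).colorings, ∀ d,
        bad (fun j => ⟨fun b w => c.1 ((j, b) : Fin (k + 1) × S.B) w, hres c.1 c.2 j⟩) d (s d) := by
      rintro ⟨c, C, hC⟩ d hsurj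
      obtain ⟨j, hj⟩ := hsurj (C (starCenter (k + 1) S.V d))
      refine C.valid (hcenter d j) ?_
      rw [← hj]
      exact hC (j, β d) (s d j)
    have hcard : f s = Nat.card {c : Fin (k + 1) → 𝒞 // ∀ d, bad c d (s d)} := by
      rw [Nat.card_eq_fintype_card, Fintype.card_subtype]
    rw [hcard]
    refine Nat.card_le_card_of_injective (fun c => ⟨_, hF c⟩) ?_
    intro c c' h
    have h' := congrArg Subtype.val h
    ext b w : 3
    exact congrFun (congrFun (congrArg Subtype.val (congrFun h' b.1)) b.2) w
  have hsum : ∑ s, f s ≤ Fintype.card 𝒞 ^ (k + 1) * (M ^ (k + 1) - 1) ^ n := by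
    have h1 : ∑ s, f s = ∑ c : Fin (k + 1) → 𝒞,
        (Finset.univ.filter fun s : Fin n → Fin (k + 1) → W => ∀ d, bad c d (s d)).card := by
      simp only [f, Finset.card_filter]
      exact Finset.sum_comm
    rw [h1]
    refine (Finset.sum_le_card_nsmul _ _ ((M ^ (k + 1) - 1) ^ n) fun c _ => ?_).trans ?_
    · have : (Finset.univ.filter fun s : Fin n → Fin (k + 1) → W => ∀ d, bad c d (s d)) =
          Fintype.piFinset fun d => Finset.univ.filter fun t => bad c d t := by
        ext s
        simp [Fintype.mem_piFinset]
      rw [this, Fintype.card_piFinset]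
      refine (Finset.prod_le_prod' fun d _ => hbad c d).trans ?_
      simp
    · simp
  have hW : Nonempty W := by
    by_contra hW
    rw [not_nonempty_iff] at hW
    exact hG (Colorable.of_isEmpty k)
  obtain ⟨s, -, hs⟩ := Finset.exists_min_image Finset.univ f Finset.univ_nonempty
  refine ⟨s, ?_⟩
  have h2 := Finset.card_nsmul_le_sum Finset.univ f (f s) hs
  have hc : S.colorings.ncard = Fintype.card 𝒞 := by
    rw [← Nat.card_eq_fintype_card]
    rfl
  rw [hc]
  refine le_trans ?_ (h2.trans hsum)
  simp only [Finset.card_univ, Fintype.card_fun, Fintype.card_fin, smul_eq_mul]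
  rw [mul_comm]
  exact Nat.mul_le_mul_left _ (hf s)

end BlockSystem

/-! ### Ordered graphs of large chromatic number without short forks -/

namespace BlockSystem

variable {W : Type} {G : SimpleGraph W} {κ ℓ : ℕ}

/-- The block system with a single block. -/
def single [LinearOrder W] [Finite W] (hG : ¬ HasFork ℓ G) : BlockSystem G κ ℓ where
  V := W
  X := G
  B := Unit
  emb _ w := w
  use _ := 0
  adj_emb _ _ _ h := h
  block_unique _ := rfl
  no_fork := hG
  degree_block _ w := by
    rw [← Set.ncard_univ]
    exact Set.ncard_le_ncard (Set.subset_univ _) (Set.toFinite _)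
  degree_center v hv := absurd rfl (hv () v)

theorem card_extend [Finite W] (S : BlockSystem G κ ℓ) (T : Finset S.B)
    (hT : ∀ b ∈ T, ∀ b' ∈ T, b ≠ b' → ¬ S.Near b b') (s : Fin T.card → Fin κ → W) :
    Fintype.card (S.extend T hT s).B = κ * Fintype.card S.B := by
  change Fintype.card (Fin κ × S.B) = _
  simp

theorem sum_use_extend [Finite W] (S : BlockSystem G κ ℓ) (T : Finset S.B)
    (hT : ∀ b ∈ T, ∀ b' ∈ T, b ≠ b' → ¬ S.Near b b') (s : Fin T.card → Fin κ → W) :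
    ∑ b, (S.extend T hT s).use b = κ * (∑ b, S.use b + T.card) := by
  classical
  change ∑ b : Fin κ × S.B, (S.use b.2 + if b.2 ∈ T then 1 else 0) = _
  rw [Fintype.sum_prod_type]
  simp only [Finset.sum_add_distrib, Finset.sum_const, Finset.card_univ, Fintype.card_fin,
    smul_eq_mul, Finset.sum_boole]
  simp [mul_add]

theorem use_extend_le [Finite W] (S : BlockSystem G κ ℓ) (T : Finset S.B)
    (hT : ∀ b ∈ T, ∀ b' ∈ T, b ≠ b' → ¬ S.Near b b') (s : Fin T.card → Fin κ → W) {D : ℕ}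
    (hD : ∀ b, S.use b ≤ D) (hTD : ∀ b ∈ T, S.use b < D) (b : (S.extend T hT s).B) :
    (S.extend T hT s).use b ≤ D := by
  classical
  change S.use b.2 + (if b.2 ∈ T then 1 else 0) ≤ D
  split_ifs with h
  exacts [hTD _ h, hD _]

/-- If less than half of the total capacity is used, then there are enough unrelated blocks with
remaining capacity. -/
theorem exists_far_blocks [Finite W] (hW : Nonempty W) (S : BlockSystem G κ ℓ) {t : ℕ}
    (hD : ∀ b, S.use b ≤ 2 * t) (hU : ∑ b, S.use b < t * Fintype.card S.B) :
    ∃ T : Finset S.B, (∀ b ∈ T, ∀ b' ∈ T, b ≠ b' → ¬ S.Near b b') ∧ (∀ b ∈ T, S.use b < 2 * t) ∧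
      Fintype.card S.B ≤ 2 * (Nat.card W * (Nat.card W + 2 * t + κ + 1) ^ ℓ) * T.card := by
  classical
  obtain ⟨T, hTA, hT, hcard⟩ := exists_pairwise_not_rel S.Near
    (fun b => ⟨hW.some, hW.some, Walk.nil, by simp⟩) (fun _ _ h => h.symm)
    (S.ncard_near_le hD) (Finset.univ.filter fun b => S.use b < 2 * t)
  refine ⟨T, hT, fun b hb => (Finset.mem_filter.1 (hTA hb)).2, ?_⟩
  have h1 := Finset.card_filter_add_card_filter_not (s := (Finset.univ : Finset S.B))
    (fun b => S.use b < 2 * t)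
  have h2 : (Finset.univ.filter fun b => ¬ S.use b < 2 * t).card * (2 * t) ≤ ∑ b, S.use b := by
    rw [← smul_eq_mul]
    refine (Finset.card_nsmul_le_sum _ S.use (2 * t) fun b hb => ?_).trans
      (Finset.sum_le_sum_of_subset (Finset.filter_subset _ _))
    exact not_lt.1 (Finset.mem_filter.1 hb).2
  have h3 : 2 * (Finset.univ.filter fun b => ¬ S.use b < 2 * t).card < Fintype.card S.B := by
    have h := h2.trans_lt hU
    rw [mul_comm t, ← mul_assoc, mul_comm _ 2] at h
    exact Nat.lt_of_mul_lt_mul_right h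
  rw [Finset.card_univ] at h1
  rw [mul_assoc, mul_comm _ T.card]
  omega

/-- Repeated star joins exclude all colorings. In terms of the number `c` of colorings, the number
`b` of blocks and the total usage `u`, the bound `c ^ (k + 1) ≤ Q ^ b * q ^ u`, where `q < 1`, is
preserved, while `u / b` grows by a constant as long as it is below `t`. -/
theorem exists_colorings_eq_empty [LinearOrder W] [Finite W] {k : ℕ} (hG : ¬ G.Colorable k)
    (hfork : ¬ HasFork ℓ G) : ∃ S : BlockSystem G (k + 1) ℓ, S.colorings = ∅ := by
  classical
  have hW : Nonempty W := by
    by_contra hW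
    rw [not_nonempty_iff] at hW
    exact hG (Colorable.of_isEmpty k)
  set M := Nat.card W with hM
  have hM0 : 0 < M := Nat.card_pos
  have hMκ : 0 < M ^ (k + 1) := pow_pos hM0 _
  set Q : ℝ := (((k + 1 : ℕ) : ℝ) ^ M) ^ (k + 1) with hQ
  set q : ℝ := ((M ^ (k + 1) - 1 : ℕ) : ℝ) / ((M ^ (k + 1) : ℕ) : ℝ) with hq
  have hMR : (0 : ℝ) < ((M ^ (k + 1) : ℕ) : ℝ) := by exact_mod_cast hMκ
  have hQ0 : 0 < Q := by positivity
  have hq0 : 0 ≤ q := by positivity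
  have hq1 : q < 1 := by
    rw [hq, div_lt_one hMR]
    exact_mod_cast Nat.sub_lt hMκ one_pos
  obtain ⟨t, ht⟩ := exists_pow_lt_of_lt_one (one_div_pos.2 hQ0) hq1
  set K := M * (M + 2 * t + (k + 1) + 1) ^ ℓ with hK
  have hK0 : 0 < K := by positivity
  let Good (S : BlockSystem G (k + 1) ℓ) : Prop := 0 < Fintype.card S.B ∧
    (S.colorings.ncard : ℝ) ^ (k + 1) ≤ Q ^ Fintype.card S.B * q ^ ∑ b, S.use b
  have key : ∀ i : ℕ, ∃ S : BlockSystem G (k + 1) ℓ, Good S ∧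
      (t * Fintype.card S.B ≤ ∑ b, S.use b ∨
        ((∀ b, S.use b ≤ 2 * t) ∧ i * Fintype.card S.B ≤ 2 * K * ∑ b, S.use b)) := by
    intro i
    induction i with
    | zero =>
      refine ⟨single hfork, ⟨Nat.one_pos, ?_⟩, Or.inr ⟨fun _ => Nat.zero_le _, by simp⟩⟩
      change _ ≤ Q ^ Fintype.card Unit * q ^ ∑ b : Unit, 0
      have : (single (κ := k + 1) hfork).colorings.ncard ≤ (k + 1) ^ M := by
        refine (Set.ncard_le_ncard (Set.subset_univ _) Set.finite_univ).trans ?_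
        rw [Set.ncard_univ]
        change Nat.card (Unit → W → Fin (k + 1)) ≤ _
        simp [Nat.card_fun, hM]
      simp only [Fintype.card_unit, pow_one, Finset.sum_const_zero, pow_zero, mul_one, hQ]
      gcongr
      exact_mod_cast this
    | succ i ih =>
      obtain ⟨S, ⟨hB, hc⟩, h⟩ := ih
      by_cases hU : t * Fintype.card S.B ≤ ∑ b, S.use b
      · exact ⟨S, ⟨hB, hc⟩, Or.inl hU⟩
      obtain ⟨hD, hi⟩ := h.resolve_left hU
      obtain ⟨T, hT, hTD, hcard⟩ := exists_far_blocks hW S hD (not_le.1 hU)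
      rw [← hM, ← hK] at hcard
      obtain ⟨s, hs⟩ := exists_extend hG S T hT
      refine ⟨S.extend T hT s, ⟨?_, ?_⟩, Or.inr ⟨S.use_extend_le T hT s hD hTD, ?_⟩⟩
      · rw [card_extend]
        positivity
      · rw [card_extend, sum_use_extend]
        have hs' : ((S.extend T hT s).colorings.ncard : ℝ) ≤
            (S.colorings.ncard : ℝ) ^ (k + 1) * q ^ T.card := by
          rw [hq, div_pow, ← mul_div_assoc, le_div_iff₀ (by positivity)]
          exact_mod_cast hs
        calc ((S.extend T hT s).colorings.ncard : ℝ) ^ (k + 1)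
            ≤ ((S.colorings.ncard : ℝ) ^ (k + 1) * q ^ T.card) ^ (k + 1) := by gcongr
          _ ≤ (Q ^ Fintype.card S.B * q ^ (∑ b, S.use b) * q ^ T.card) ^ (k + 1) := by gcongr
          _ = _ := by ring
      · rw [card_extend, sum_use_extend]
        have : (i + 1) * Fintype.card S.B ≤ 2 * K * (∑ b, S.use b + T.card) := by
          rw [add_mul, mul_add, one_mul]
          exact add_le_add hi hcard
        calc (i + 1) * ((k + 1) * Fintype.card S.B)
            = (k + 1) * ((i + 1) * Fintype.card S.B) := by ring
          _ ≤ (k + 1) * (2 * K * (∑ b, S.use b + T.card)) := Nat.mul_le_mul_left _ this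
          _ = _ := by ring
  obtain ⟨S, ⟨hB, hc⟩, h⟩ := key (2 * K * t)
  refine ⟨S, ?_⟩
  have hU : t * Fintype.card S.B ≤ ∑ b, S.use b := by
    rcases h with h | ⟨-, h⟩
    · exact h
    · rw [mul_assoc] at h
      exact Nat.le_of_mul_le_mul_left h (by positivity)
  have hlt : (S.colorings.ncard : ℝ) ^ (k + 1) < 1 := by
    calc (S.colorings.ncard : ℝ) ^ (k + 1) ≤ Q ^ Fintype.card S.B * q ^ ∑ b, S.use b := hc
      _ ≤ Q ^ Fintype.card S.B * q ^ (t * Fintype.card S.B) := by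
          gcongr ?_ * ?_
          exact pow_le_pow_of_le_one hq0 hq1.le hU
      _ = (Q * q ^ t) ^ Fintype.card S.B := by rw [mul_pow, pow_mul]
      _ < 1 := by
          refine pow_lt_one₀ (by positivity) ?_ hB.ne'
          rwa [lt_div_iff₀ hQ0, mul_comm] at ht
  have hzero : S.colorings.ncard = 0 := by
    by_contra hne
    have : (1 : ℝ) ≤ S.colorings.ncard := by exact_mod_cast Nat.one_le_iff_ne_zero.2 hne
    exact absurd (one_le_pow₀ this) (not_le.2 hlt)
  have : Finite (S.B → W → Fin (k + 1)) := inferInstance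
  exact (Set.ncard_eq_zero (Set.toFinite _)).1 hzero

end BlockSystem

/-- There are ordered graphs of arbitrarily large chromatic number without short forks. -/
theorem exists_not_hasFork_not_colorable (ℓ k : ℕ) :
    ∃ (V : Type) (_ : LinearOrder V) (_ : Finite V) (G : SimpleGraph V),
      ¬ HasFork ℓ G ∧ ¬ G.Colorable k := by
  induction k with
  | zero =>
    refine ⟨Unit, inferInstance, inferInstance, ⊥, ?_, ?_⟩
    · rintro ⟨m, u, v, p, q, -, -, -, -, -, -, -, e, he, -⟩
      have := p.edges_subset_edgeSet he
      simp at this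
    · rintro ⟨C⟩
      exact (C ()).elim0
  | succ k ih =>
    obtain ⟨W, _, _, G, hfork, hG⟩ := ih
    obtain ⟨S, hS⟩ := BlockSystem.exists_colorings_eq_empty hG hfork
    refine ⟨S.V, S.ord, S.fin, S.X, S.no_fork, ?_⟩
    rintro ⟨C⟩
    have : (fun b w => C (S.emb b w)) ∈ S.colorings := ⟨C, fun _ _ => rfl⟩
    rw [hS] at this
    exact this

/-! ### Hosts of large chromatic number -/

section LowerBounds

variable {V : Type*} [LinearOrder V]

theorem fPrec_eq_top {H : SimpleGraph V}
    (h : ∀ k : ℕ, ∃ (U : Type) (_ : LinearOrder U) (_ : Finite U) (G : SimpleGraph U),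
      ¬ ContainsCopy H G ∧ ¬ G.Colorable k) : fPrec H = ⊤ := by
  by_contra hne
  obtain ⟨k, hk⟩ := ENat.ne_top_iff_exists.1 hne
  obtain ⟨U, _, _, G, hG, hGk⟩ := h k
  have := Fintype.ofFinite U
  let e : Fin (Fintype.card U) ≃o U := monoEquivOfFin U rfl
  refine hGk ?_
  have hle : (G.comap e).chromaticNumber ≤ fPrec H := by
    refine le_sSup ⟨Fintype.card U, G.comap e, ?_, rfl⟩
    rintro ⟨φ, hφ⟩
    exact hG ⟨(Hom.comap e G).comp φ, e.strictMono.comp hφ⟩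
  rw [← hk, chromaticNumber_le_iff_colorable] at hle
  refine hle.of_hom ⟨e.symm, fun {a b} hab => ?_⟩
  simpa using hab

/-- The shift graph: two pairs `i < j` and `j < k` that share the middle number are adjacent. The
pairs are ordered lexicographically, and the remaining pairs are isolated vertices. -/
def shiftGraph (n : ℕ) : SimpleGraph (Fin n ×ₗ Fin n) where
  Adj x y :=
    ((ofLex x).2 = (ofLex y).1 ∧ (ofLex x).1 < (ofLex x).2 ∧ (ofLex y).1 < (ofLex y).2) ∨
    ((ofLex y).2 = (ofLex x).1 ∧ (ofLex y).1 < (ofLex y).2 ∧ (ofLex x).1 < (ofLex x).2)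
  symm := ⟨fun _ _ h => h.symm⟩
  loopless := ⟨fun x h => by
    rcases h with ⟨h1, h2, -⟩ | ⟨h1, h2, -⟩ <;> exact absurd h1 h2.ne'⟩

theorem shiftGraph_adj_of_lt {n : ℕ} {x y : Fin n ×ₗ Fin n} (h : (shiftGraph n).Adj x y)
    (hxy : x < y) : (ofLex y).1 = (ofLex x).2 ∧ (ofLex x).1 < (ofLex y).1 := by
  rcases h with ⟨h1, h2, -⟩ | ⟨h1, h2, -⟩
  · exact ⟨h1.symm, h1 ▸ h2⟩
  · rw [Prod.Lex.lt_iff] at hxy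
    rcases hxy with h | ⟨h, -⟩
    · exact absurd (h1 ▸ h2) h.asymm
    · exact absurd (h1 ▸ h2) h.not_gt

theorem not_hasLeftBonnet_shiftGraph (n : ℕ) : ¬ HasLeftBonnet (shiftGraph n) := by
  rintro ⟨u₁, u₂, u₃, u₄, u₅, h12, h23, h34, h45, -, a12, a15, a34⟩
  have h2 := (shiftGraph_adj_of_lt a12 h12).1
  have h5 := (shiftGraph_adj_of_lt a15 (h12.trans_le (h23.trans (h34.le.trans h45)))).1
  have h34' := (shiftGraph_adj_of_lt a34 h34).2
  have h23' := Prod.Lex.monotone_fst _ _ h23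
  have h45' := Prod.Lex.monotone_fst _ _ h45
  exact absurd (h23'.trans_lt (h34'.trans_le h45')) (by rw [h2, h5]; exact lt_irrefl _)

theorem shiftGraph_not_triangle {n : ℕ} {x y z : Fin n ×ₗ Fin n} (hxy : x < y) (hyz : y < z)
    (axy : (shiftGraph n).Adj x y) (ayz : (shiftGraph n).Adj y z) : ¬ (shiftGraph n).Adj x z := by
  intro axz
  have h1 := (shiftGraph_adj_of_lt axy hxy).1
  have h2 := (shiftGraph_adj_of_lt axz (hxy.trans hyz)).1
  have h3 := (shiftGraph_adj_of_lt ayz hyz).2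
  rw [h1, h2] at h3
  exact lt_irrefl _ h3

/-- The sets of colors of the pairs with a given first entry are distinct. -/
theorem not_colorable_shiftGraph {n k : ℕ} (h : 2 ^ k < n) : ¬ (shiftGraph n).Colorable k := by
  rintro ⟨c⟩
  let S : Fin n → Set (Fin k) := fun i => {a | ∃ j, i < j ∧ c (toLex (i, j)) = a}
  have key : ∀ i j, i < j → S i ≠ S j := by
    intro i j hij heq
    have h1 : c (toLex (i, j)) ∈ S j := heq ▸ ⟨j, hij, rfl⟩
    obtain ⟨l, hl, hc⟩ := h1
    exact c.valid (v := toLex (i, j)) (w := toLex (j, l)) (Or.inl ⟨rfl, hij, hl⟩) hc.symm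
  have hinj : Function.Injective S := by
    intro i j hij
    rcases lt_trichotomy i j with h | h | h
    exacts [absurd hij (key _ _ h), h, absurd hij.symm (key _ _ h)]
  have := Fintype.card_le_of_injective S hinj
  simp only [Fintype.card_fin, Fintype.card_set] at this
  omega

theorem containsCopy_orderDual {W : Type*} [LinearOrder W] {H : SimpleGraph V} {G : SimpleGraph W}
    (h : ContainsCopy (W := Wᵒᵈ) H G) : ContainsCopy (V := Vᵒᵈ) H G := by
  obtain ⟨φ, hφ⟩ := h
  exact ⟨φ, fun a b hab => hφ (a := b) (b := a) hab⟩

/-- A bonnet, a tangled path or a triangle in `H` excludes copies of `H` from hosts of unbounded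
chromatic number: shift graphs, graphs without short forks, or their mirror images. -/
theorem no_obstruction_of_fPrec_ne_top {H : SimpleGraph V} (hH : fPrec H ≠ ⊤) :
    ¬ ContainsBonnet H ∧ ¬ ContainsTangledPath H ∧
      ∀ x y z, x < y → y < z → H.Adj x y → H.Adj y z → ¬ H.Adj x z := by
  refine ⟨fun hb => hH ?_, fun ht => hH ?_, fun x y z hxy hyz axy ayz axz => hH ?_⟩
  · rcases (containsBonnet_iff H).1 hb with hb | hb
    · refine fPrec_eq_top fun k => ⟨Fin (2 ^ k + 1) ×ₗ Fin (2 ^ k + 1), inferInstance,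
        inferInstance, shiftGraph _, fun hc => ?_, not_colorable_shiftGraph (Nat.lt_succ_self _)⟩
      exact not_hasLeftBonnet_shiftGraph _ (hb.of_copy hc)
    · refine fPrec_eq_top fun k => ⟨(Fin (2 ^ k + 1) ×ₗ Fin (2 ^ k + 1))ᵒᵈ, inferInstance,
        inferInstanceAs (Finite (Fin (2 ^ k + 1) ×ₗ Fin (2 ^ k + 1))), shiftGraph _, fun hc => ?_,
        not_colorable_shiftGraph (Nat.lt_succ_self _)⟩
      exact not_hasLeftBonnet_shiftGraph _ (hb.of_copy (containsCopy_orderDual hc))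
  · obtain ⟨ℓ, ht | ht⟩ := (containsTangledPath_iff H).1 ht
    · refine fPrec_eq_top fun k => ?_
      obtain ⟨U, i, hU, G, hG, hk⟩ := exists_not_hasFork_not_colorable ℓ k
      exact ⟨U, i, hU, G, fun hc => hG (ht.of_copy hc), hk⟩
    · refine fPrec_eq_top fun k => ?_
      obtain ⟨U, i, hU, G, hG, hk⟩ := exists_not_hasFork_not_colorable ℓ k
      exact ⟨Uᵒᵈ, inferInstance, hU, G, fun hc => hG (ht.of_copy (containsCopy_orderDual hc)), hk⟩
  · refine fPrec_eq_top fun k => ⟨Fin (2 ^ k + 1) ×ₗ Fin (2 ^ k + 1), inferInstance,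
        inferInstance, shiftGraph _, ?_, not_colorable_shiftGraph (Nat.lt_succ_self _)⟩
    rintro ⟨φ, hφ⟩
    exact shiftGraph_not_triangle (hφ hxy) (hφ hyz) (φ.map_adj axy) (φ.map_adj ayz)
      (φ.map_adj axz)

end LowerBounds

/-! ### Cycles -/

section Acyclic

variable {V : Type*} [LinearOrder V] {G : SimpleGraph V}

/-- Two neighbors `b < c` of `a` to its right and a further neighbor `d` of `c` between `a` and `c`
form a fork, a triangle or a bonnet, according to the order of `d` and `b`. -/
theorem no_zigzag (hT : ∀ x y z, x < y → y < z → G.Adj x y → G.Adj y z → ¬ G.Adj x z)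
    (hB : ¬ HasLeftBonnet G) (hF : ∀ ℓ, ¬ HasFork ℓ G) {a b c d : V} (hab : G.Adj a b)
    (hac : G.Adj a c) (hdc : G.Adj d c) (h1 : a < b) (h2 : b < c) (h3 : a < d) (h4 : d < c) :
    False := by
  rcases lt_trichotomy d b with hdb | rfl | hdb
  · obtain ⟨ℓ, hℓ⟩ := hasFork_of_walks (m := a) (p := Walk.cons hab Walk.nil)
      (q := Walk.cons hac (Walk.cons hdc.symm Walk.nil)) (e := s(a, b)) (f := s(c, d))
      (by simp [hab.ne]) (by simp [hac.ne, h3.ne, hdc.ne'])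
      (by
        intro v hv hv'
        simp only [Walk.support_cons, Walk.support_nil, List.mem_cons, List.not_mem_nil,
          or_false] at hv hv'
        rcases hv with rfl | rfl
        · rfl
        · rcases hv' with h | h | h
          exacts [h, absurd h h2.ne, absurd h hdb.ne'])
      (by simp [h1.le]) (by simp [h3.le, (h1.trans h2).le])
      (by simp) (by simp)
      (by rw [Sym2.eq_swap (a := c)]; exact edgesCross_mk h3 hdb h2)
    exact hF ℓ hℓ
  · exact hT a d c h3 h4 hab hdc hac
  · exact hB ⟨a, b, d, c, c, h1, hdb.le, h4, le_rfl, fun h => hdb.ne h.1, hab, hac, hdc⟩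

/-- There is no cycle through `a` with all other vertices to its right: the path `Q` between the
neighbors `b < c` of `a` stays left of `c`, as an edge across `c` would cross `ac`, and its last
edge then yields a zigzag. -/
theorem not_cycle_at_min (hT : ∀ x y z, x < y → y < z → G.Adj x y → G.Adj y z → ¬ G.Adj x z)
    (hB : ¬ HasLeftBonnet G) (hF : ∀ ℓ, ¬ HasFork ℓ G) {a b c : V} (hab : G.Adj a b)
    (hac : G.Adj a c) (hbc : b < c) {Q : G.Walk b c} (hQ : Q.IsPath)
    (ha : ∀ z ∈ Q.support, a < z) : False := by
  classical
  have hle : ∀ z ∈ Q.support, z ≤ c := by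
    intro z hz
    by_contra hzc
    rw [not_le] at hzc
    have hcQ : c ∉ (Q.takeUntil z hz).support :=
      Walk.endpoint_notMem_support_takeUntil hQ hz hzc.ne
    obtain ⟨y, x, p₁, h, p₂, hp, hP, hx⟩ :=
      exists_exit (P := fun v => v < c) (Q.takeUntil z hz) hbc hzc.not_gt
    have hsub : ∀ v ∈ (Q.takeUntil z hz).support, a < v := fun v hv =>
      ha v (Q.support_takeUntil_subset_support hz hv)
    have hy : y ∈ (Q.takeUntil z hz).support := by rw [hp]; simp
    have hx' : x ∈ (Q.takeUntil z hz).support := by rw [hp]; simp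
    have hxc : c < x := lt_of_le_of_ne (not_lt.1 hx) fun h => hcQ (h ▸ hx')
    obtain ⟨ℓ, hℓ⟩ := hasFork_of_walks (p := Walk.cons hac Walk.nil)
      (q := Walk.cons hab (Q.takeUntil z hz)) (e := s(a, c)) (f := s(y, x))
      (by simp [hac.ne])
      (by rw [Walk.cons_isPath_iff]; exact ⟨hQ.takeUntil hz, fun h => (hsub _ h).false⟩)
      (by
        intro v hv hv'
        simp only [Walk.support_cons, Walk.support_nil, List.mem_cons, List.not_mem_nil,
          or_false] at hv hv'
        rcases hv with rfl | rfl
        · rfl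
        · rcases hv' with h | h
          · exact h
          · exact absurd h hcQ)
      (by
        intro v hv
        simp only [Walk.support_cons, Walk.support_nil, List.mem_cons, List.not_mem_nil,
          or_false] at hv
        rcases hv with rfl | rfl
        exacts [le_rfl, (ha _ Q.end_mem_support).le])
      (by
        intro v hv
        rw [Walk.support_cons, List.mem_cons] at hv
        rcases hv with rfl | hv
        exacts [le_rfl, (hsub _ hv).le])
      (by simp) (by rw [hp]; simp)
      (edgesCross_mk (hsub _ hy) (hP y p₁.end_mem_support) hxc)
    exact hF ℓ hℓ
  obtain ⟨d, Q', hdc, rfl⟩ : ∃ (d : V) (Q' : G.Walk b d) (h : G.Adj d c), Q = Q'.concat h := by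
    cases Q with
    | nil => exact absurd hbc (lt_irrefl _)
    | cons h p =>
      obtain ⟨x, q, h', hq⟩ := Walk.exists_cons_eq_concat h p
      exact ⟨x, q, h', hq⟩
  have hd : d ∈ (Q'.concat hdc).support := by simp [Walk.support_concat]
  have hb : b ∈ (Q'.concat hdc).support := by simp
  have hdc' : d < c := lt_of_le_of_ne (hle d hd) hdc.ne
  exact no_zigzag hT hB hF hab hac hdc (ha b hb) hbc (ha d hd) hdc'

theorem isAcyclic_of_no_obstruction
    (hT : ∀ x y z, x < y → y < z → G.Adj x y → G.Adj y z → ¬ G.Adj x z)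
    (hB : ¬ HasLeftBonnet G) (hF : ∀ ℓ, ¬ HasFork ℓ G) : G.IsAcyclic := by
  classical
  intro v c hc
  obtain ⟨a, ha, hmin⟩ := c.support.toFinset.exists_min_image id ⟨v, by simp⟩
  simp only [List.mem_toFinset, id] at ha hmin
  obtain ⟨c', hc', hsub⟩ : ∃ c' : G.Walk a a, c'.IsCycle ∧ ∀ z ∈ c'.support, a ≤ z :=
    ⟨c.rotate a ha, hc.rotate ha, fun z hz => hmin z (by
      rwa [Walk.mem_support_rotate_iff] at hz)⟩
  cases c' with
  | nil => exact absurd hc' (by simp)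
  | @cons _ b _ hab p =>
    rw [Walk.cons_isCycle_iff] at hc'
    obtain ⟨hp, hpe⟩ := hc'
    obtain ⟨r, hr⟩ : ∃ r : G.Walk a b, r = p.reverse := ⟨_, rfl⟩
    have hrp : r.IsPath := by rw [hr]; exact hp.reverse
    have hre : s(a, b) ∉ r.edges := by rw [hr]; simpa using hpe
    have hrs : ∀ z ∈ r.support, a ≤ z := by
      intro z hz
      refine hsub z ?_
      rw [hr] at hz
      simpa using Or.inr hz
    cases r with
    | nil => exact hab.ne rfl
    | @cons _ c _ hac q =>
      rw [Walk.cons_isPath_iff] at hrp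
      have haq : ∀ z ∈ q.support, a < z := fun z hz =>
        lt_of_le_of_ne (hrs z (by simp [hz])) fun h => hrp.2 (h ▸ hz)
      rcases lt_trichotomy b c with hbc | rfl | hbc
      · exact not_cycle_at_min hT hB hF hab hac hbc hrp.1.reverse (by simpa using haq)
      · exact hre (by simp)
      · exact not_cycle_at_min hT hB hF hac hab hbc hrp.1 haq

end Acyclic

/-! ### Alternating splits -/

section Alternating

variable {V : Type*} [LinearOrder V] {G : SimpleGraph V}

/-- Monotone alternation of `G` with respect to a partition of the vertices into a left part `L` and
a right part `R`, stated with the nearest neighbors of the vertices instead of edge lengths. This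
form is invariant under reversing the order and exchanging `L` and `R`. -/
structure IsAlternatingSplit (G : SimpleGraph V) (L R : Set V) : Prop where
  cover : ∀ x, x ∈ L ∨ x ∈ R
  lt : ∀ l ∈ L, ∀ r ∈ R, l < r
  mem_of_adj : ∀ x y, G.Adj x y → x < y → x ∈ L ∧ y ∈ R
  near : ∀ l r, G.Adj l r → l < r → (∀ r', G.Adj l r' → r ≤ r') ∨ (∀ l', G.Adj l' r → l' ≤ l)
  nocross_left : ∀ l r l' r', G.Adj l r → G.Adj l' r' → l < l' → l' < r → r < r' →
    (∀ x, G.Adj l x → r ≤ x) → ¬ ∀ x, G.Adj l' x → r' ≤ x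
  nocross_right : ∀ l r l' r', G.Adj l r → G.Adj l' r' → l < l' → l' < r → r < r' →
    (∀ x, G.Adj x r → x ≤ l) → ¬ ∀ x, G.Adj x r' → x ≤ l'

theorem IsAlternatingSplit.dual {L R : Set V} (h : IsAlternatingSplit G L R) :
    IsAlternatingSplit (V := Vᵒᵈ) G R L where
  cover x := (h.cover x).symm
  lt r hr l hl := h.lt l hl r hr
  mem_of_adj x y hxy hlt := (h.mem_of_adj y x hxy.symm hlt).symm
  near r l hrl hlt := (h.near l r hrl.symm hlt).symm.imp
    (fun H l' hl' => H l' hl'.symm) (fun H r' hr' => H r' hr'.symm)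
  nocross_left r l r' l' h1 h2 h3 h4 h5 H H' :=
    h.nocross_right l' r' l r h2.symm h1.symm h5 h4 h3 (fun x hx => H' x hx.symm)
      (fun x hx => H x hx.symm)
  nocross_right r l r' l' h1 h2 h3 h4 h5 H H' :=
    h.nocross_left l' r' l r h2.symm h1.symm h5 h4 h3 (fun x hx => H' x hx.symm)
      (fun x hx => H x hx.symm)

theorem edgeLength_mk {x y : V} (h : x < y) : edgeLength s(x, y) = (Set.Ico x y).ncard := by
  simp [edgeLength, h.le]

theorem isShortestEdge_iff_of_left [Finite V] {l : V} (hl : ∀ y, G.Adj l y → l < y) {e : Sym2 V} :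
    IsShortestEdge G l e ↔ ∃ r, e = s(l, r) ∧ G.Adj l r ∧ ∀ x, G.Adj l x → r ≤ x := by
  have key : ∀ x y, G.Adj l x → G.Adj l y →
      (edgeLength s(l, x) ≤ edgeLength s(l, y) ↔ x ≤ y) := by
    intro x y hx hy
    rw [edgeLength_mk (hl x hx), edgeLength_mk (hl y hy)]
    refine ⟨fun h => ?_, fun h => Set.ncard_le_ncard (Set.Ico_subset_Ico_right h) (Set.toFinite _)⟩
    by_contra hlt
    rw [not_le] at hlt
    refine absurd h (not_le.2 (Set.ncard_lt_ncard ⟨Set.Ico_subset_Ico_right hlt.le, fun hs => ?_⟩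
      (Set.toFinite _)))
    exact absurd (hs ⟨(hl y hy).le, hlt⟩).2 (lt_irrefl _)
  constructor
  · rintro ⟨⟨he, hmem⟩, hmin⟩
    obtain ⟨r, rfl⟩ := hmem
    refine ⟨r, rfl, he, fun x hx => (key r x he hx).1 (hmin _ ⟨hx, by simp⟩)⟩
  · rintro ⟨r, rfl, hr, hmin⟩
    refine ⟨⟨hr, by simp⟩, ?_⟩
    rintro f ⟨hf, hmem⟩
    obtain ⟨x, rfl⟩ := hmem
    exact (key r x hr hf).2 (hmin x hf)

theorem isShortestEdge_iff_of_right [Finite V] {r : V} (hr : ∀ x, G.Adj x r → x < r)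
    {e : Sym2 V} :
    IsShortestEdge G r e ↔ ∃ l, e = s(l, r) ∧ G.Adj l r ∧ ∀ x, G.Adj x r → x ≤ l := by
  have key : ∀ x y, G.Adj x r → G.Adj y r →
      (edgeLength s(x, r) ≤ edgeLength s(y, r) ↔ y ≤ x) := by
    intro x y hx hy
    rw [edgeLength_mk (hr x hx), edgeLength_mk (hr y hy)]
    refine ⟨fun h => ?_, fun h => Set.ncard_le_ncard (Set.Ico_subset_Ico_left h) (Set.toFinite _)⟩
    by_contra hlt
    rw [not_le] at hlt
    refine absurd h (not_le.2 (Set.ncard_lt_ncard ⟨Set.Ico_subset_Ico_left hlt.le, fun hs => ?_⟩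
      (Set.toFinite _)))
    exact absurd (hs ⟨le_rfl, hr x hx⟩).1 (not_le.2 hlt)
  constructor
  · rintro ⟨⟨he, hmem⟩, hmin⟩
    obtain ⟨l, rfl⟩ := hmem
    have he' : G.Adj l r := G.adj_symm he
    refine ⟨l, Sym2.eq_swap, he', fun x hx => (key l x he' hx).1 ?_⟩
    rw [Sym2.eq_swap]
    exact hmin _ ⟨hx, by simp⟩
  · rintro ⟨l, rfl, hl, hmin⟩
    refine ⟨⟨hl, by simp⟩, ?_⟩
    rintro f ⟨hf, hmem⟩
    obtain ⟨x, rfl⟩ := hmem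
    have hf' : G.Adj x r := G.adj_symm hf
    rw [Sym2.eq_swap (a := r)]
    exact (key l x hl hf').2 (hmin x hf')

theorem isMonotonicallyAlternating_iff [Finite V] :
    IsMonotonicallyAlternating G ↔ G.IsTree ∧ ∃ L R, IsAlternatingSplit G L R := by
  refine and_congr_right fun _ => exists₂_congr fun L R => ?_
  constructor
  · rintro ⟨hU, -, hlt, hL, hR, -, hE, hcL, hcR⟩
    have cover : ∀ x, x ∈ L ∨ x ∈ R := fun x => by
      have : x ∈ L ∪ R := hU ▸ Set.mem_univ x
      exact this
    have mem : ∀ x y, G.Adj x y → x < y → x ∈ L ∧ y ∈ R := by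
      intro x y hxy h
      rcases cover x with hx | hx <;> rcases cover y with hy | hy
      · exact absurd hxy (hL x hx y hy)
      · exact ⟨hx, hy⟩
      · exact absurd (hlt y hy x hx) h.asymm
      · exact absurd hxy (hR x hx y hy)
    have disj : ∀ x ∈ L, x ∉ R := fun x hx hx' => lt_irrefl _ (hlt x hx x hx')
    have left : ∀ l ∈ L, ∀ y, G.Adj l y → l < y := by
      intro l hl y hy
      by_contra h
      exact disj l hl (mem y l hy.symm (lt_of_le_of_ne (not_lt.1 h) hy.ne')).2
    have right : ∀ r ∈ R, ∀ x, G.Adj x r → x < r := by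
      intro r hr x hx
      by_contra h
      exact disj r (mem r x hx.symm (lt_of_le_of_ne (not_lt.1 h) hx.ne')).1 hr
    refine ⟨cover, hlt, mem, ?_, ?_, ?_⟩
    · intro l r hlr h
      obtain ⟨hl, hr⟩ := mem l r hlr h
      have hmem : s(l, r) ∈ shortestEdges G L ∪ shortestEdges G R := hE ▸ hlr
      rcases hmem with ⟨u, hu, hs⟩ | ⟨u, hu, hs⟩
      · left
        have : u ∈ s(l, r) := hs.1.2
        rw [Sym2.mem_iff] at this
        obtain rfl : u = l := this.resolve_right fun h => disj u hu (h ▸ hr)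
        obtain ⟨r', he, -, hmin⟩ := (isShortestEdge_iff_of_left (left u hu)).1 hs
        rwa [Sym2.congr_right.1 he]
      · right
        have : u ∈ s(l, r) := hs.1.2
        rw [Sym2.mem_iff] at this
        obtain rfl : u = r := this.resolve_left fun h => disj u (h ▸ hl) hu
        obtain ⟨l', he, -, hmin⟩ := (isShortestEdge_iff_of_right (right u hu)).1 hs
        rwa [Sym2.congr_left.1 he]
    · intro l r l' r' h1 h2 h3 h4 h5 hm hm'
      have hl := (mem l r h1 (h3.trans h4)).1
      have hl' := (mem l' r' h2 (h4.trans h5)).1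
      exact hcL _ ⟨l, hl, (isShortestEdge_iff_of_left (left l hl)).2 ⟨r, rfl, h1, hm⟩⟩ _
        ⟨l', hl', (isShortestEdge_iff_of_left (left l' hl')).2 ⟨r', rfl, h2, hm'⟩⟩
        (edgesCross_mk h3 h4 h5)
    · intro l r l' r' h1 h2 h3 h4 h5 hm hm'
      have hr := (mem l r h1 (h3.trans h4)).2
      have hr' := (mem l' r' h2 (h4.trans h5)).2
      exact hcR _ ⟨r, hr, (isShortestEdge_iff_of_right (right r hr)).2 ⟨l, rfl, h1, hm⟩⟩ _
        ⟨r', hr', (isShortestEdge_iff_of_right (right r' hr')).2 ⟨l', rfl, h2, hm'⟩⟩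
        (edgesCross_mk h3 h4 h5)
  · intro h
    have disj : ∀ x ∈ L, x ∉ R := fun x hx hx' => lt_irrefl _ (h.lt x hx x hx')
    have left : ∀ l ∈ L, ∀ y, G.Adj l y → l < y := by
      intro l hl y hy
      by_contra hly
      exact disj l hl (h.mem_of_adj y l hy.symm (lt_of_le_of_ne (not_lt.1 hly) hy.ne')).2
    have right : ∀ r ∈ R, ∀ x, G.Adj x r → x < r := by
      intro r hr x hx
      by_contra hxr
      exact disj r (h.mem_of_adj r x hx.symm (lt_of_le_of_ne (not_lt.1 hxr) hx.ne')).1 hr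
    have mk_inj : ∀ {a b c d : V}, a < b → c < d → s(a, b) = s(c, d) → a = c ∧ b = d := by
      intro a b c d hab hcd he
      rcases Sym2.eq_iff.1 he with h | ⟨rfl, rfl⟩
      exacts [h, absurd hab hcd.asymm]
    refine ⟨Set.eq_univ_of_forall h.cover, Set.disjoint_left.2 disj, h.lt,
      fun x hx y hy hxy => ?_, fun x hx y hy hxy => ?_, fun u e f he hf => ?_, ?_, ?_, ?_⟩
    · exact lt_asymm (left x hx y hxy) (left y hy x hxy.symm)
    · exact lt_asymm (right x hx y hxy.symm) (right y hy x hxy)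
    · rcases h.cover u with hu | hu
      · obtain ⟨x, rfl, hx, hx'⟩ := (isShortestEdge_iff_of_left (left u hu)).1 he
        obtain ⟨y, rfl, hy, hy'⟩ := (isShortestEdge_iff_of_left (left u hu)).1 hf
        rw [le_antisymm (hx' y hy) (hy' x hx)]
      · obtain ⟨x, rfl, hx, hx'⟩ := (isShortestEdge_iff_of_right (right u hu)).1 he
        obtain ⟨y, rfl, hy, hy'⟩ := (isShortestEdge_iff_of_right (right u hu)).1 hf
        rw [le_antisymm (hx' y hy) (hy' x hx)]
    · ext e
      constructor
      · induction e using Sym2.ind with | _ x y => ?_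
        intro hxy
        wlog hlt : x < y generalizing x y
        · rw [Sym2.eq_swap] at hxy ⊢
          exact this y x hxy (lt_of_le_of_ne (not_lt.1 hlt) (G.ne_of_adj hxy))
        obtain ⟨hx, hy⟩ := h.mem_of_adj x y hxy hlt
        rcases h.near x y hxy hlt with hn | hn
        · exact Or.inl ⟨x, hx, (isShortestEdge_iff_of_left (left x hx)).2 ⟨y, rfl, hxy, hn⟩⟩
        · exact Or.inr ⟨y, hy, (isShortestEdge_iff_of_right (right y hy)).2 ⟨x, rfl, hxy, hn⟩⟩
      · rintro (⟨u, -, hu⟩ | ⟨u, -, hu⟩)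
        exacts [hu.1.1, hu.1.1]
    · rintro e he f hf ⟨a, b, c, d, hef, h1, h2, h3⟩
      wlog hord : e = s(a, b) ∧ f = s(c, d) generalizing e f
      · exact this f hf e he hef.symm (hef.resolve_left hord)
      obtain ⟨u, hu, hue⟩ := he
      obtain ⟨w, hw, hwf⟩ := hf
      obtain ⟨x, rfl, hx, hx'⟩ := (isShortestEdge_iff_of_left (left u hu)).1 hue
      obtain ⟨y, rfl, hy, hy'⟩ := (isShortestEdge_iff_of_left (left w hw)).1 hwf
      obtain ⟨rfl, rfl⟩ := mk_inj (left u hu x hx) (h1.trans h2) hord.1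
      obtain ⟨rfl, rfl⟩ := mk_inj (left w hw y hy) (h2.trans h3) hord.2
      exact h.nocross_left _ _ _ _ hx hy h1 h2 h3 hx' hy'
    · rintro e he f hf ⟨a, b, c, d, hef, h1, h2, h3⟩
      wlog hord : e = s(a, b) ∧ f = s(c, d) generalizing e f
      · exact this f hf e he hef.symm (hef.resolve_left hord)
      obtain ⟨u, hu, hue⟩ := he
      obtain ⟨w, hw, hwf⟩ := hf
      obtain ⟨x, rfl, hx, hx'⟩ := (isShortestEdge_iff_of_right (right u hu)).1 hue
      obtain ⟨y, rfl, hy, hy'⟩ := (isShortestEdge_iff_of_right (right w hw)).1 hwf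
      obtain ⟨rfl, rfl⟩ := mk_inj (right u hu x hx) (h1.trans h2) hord.1
      obtain ⟨rfl, rfl⟩ := mk_inj (right w hw y hy) (h2.trans h3) hord.2
      exact h.nocross_right _ _ _ _ hx hy h1 h2 h3 hx' hy'

theorem IsAlternatingSplit.not_hasLeftBonnet {L R : Set V} (h : IsAlternatingSplit G L R) :
    ¬ HasLeftBonnet G := by
  rintro ⟨u₁, u₂, u₃, u₄, u₅, h12, h23, h34, -, -, a12, -, a34⟩
  exact absurd (h.lt _ (h.mem_of_adj _ _ a34 h34).1 _ (h.mem_of_adj _ _ a12 h12).2) h23.not_gt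

/-- In an alternating split a fork cannot exist: of its two legs the one with the larger second
vertex `c` is the single edge `mc`, because `m` is the nearest neighbor of `c`. If the other leg
crossed this edge, its first vertex `x` beyond `c` would be reached from some `y` between `m` and
`c`. The edge `yx` is not nearest for `y`, as the predecessor of `y` lies left of `c`, and not
nearest for `x`, as the nearest edges of `c` and `x` would cross. -/
theorem IsAlternatingSplit.not_edgesCross {L R : Set V} (h : IsAlternatingSplit G L R)
    {m u v c c' : V} (hc : G.Adj m c) (hc' : G.Adj m c') {p : G.Walk c u} {q : G.Walk c' v}
    (hp : (Walk.cons hc p).IsPath) (hq : (Walk.cons hc' q).IsPath)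
    (hpq : ∀ x ∈ (Walk.cons hc p).support, x ∈ (Walk.cons hc' q).support → x = m)
    (hpm : ∀ x ∈ (Walk.cons hc p).support, m ≤ x) (hqm : ∀ x ∈ (Walk.cons hc' q).support, m ≤ x)
    (hlt : c' < c) {e f : Sym2 V} (he : e ∈ (Walk.cons hc p).edges)
    (hf : f ∈ (Walk.cons hc' q).edges) : ¬ EdgesCross e f := by
  classical
  intro hcross
  have hmc : m < c := lt_of_le_of_ne (hpm c (by simp)) hc.ne
  have hmc' : m < c' := lt_of_le_of_ne (hqm c' (by simp)) hc'.ne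
  have hcR := (h.mem_of_adj m c hc hmc).2
  have hc'R := (h.mem_of_adj m c' hc' hmc').2
  have disj : ∀ x ∈ L, x ∉ R := fun x hx hx' => lt_irrefl _ (h.lt x hx x hx')
  have hnear : ∀ x, G.Adj x c → x ≤ m :=
    (h.near m c hc hmc).resolve_left fun H => absurd (H c' hc') hlt.not_ge
  rw [Walk.cons_isPath_iff] at hp hq
  obtain rfl : e = s(m, c) := by
    cases p with
    | nil => simpa using he
    | @cons _ d _ hd p =>
      exact absurd (le_antisymm (hnear d hd.symm) (hpm d (by simp)))
        fun hdm => hp.2 (by simp [← hdm])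
  obtain ⟨z, hz, hcz⟩ : ∃ z ∈ q.support, c < z := by
    obtain ⟨a, b, a', b', hef, h1, h2, h3⟩ := hcross
    have hmem : ∀ w ∈ f, w ∈ (Walk.cons hc' q).support := fun w hw =>
      Walk.mem_support_of_mem_edges hf hw
    have key : ∃ z ∈ f, c < z := by
      rcases hef with ⟨h4, rfl⟩ | ⟨rfl, h4⟩
      · rcases Sym2.eq_iff.1 h4 with ⟨rfl, rfl⟩ | ⟨rfl, rfl⟩
        · exact ⟨b', by simp, h3⟩
        · exact absurd (h1.trans h2) hmc.asymm
      · have := hqm a (hmem a (by simp))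
        rcases Sym2.eq_iff.1 h4 with ⟨rfl, rfl⟩ | ⟨rfl, rfl⟩
        · exact absurd h1 this.not_gt
        · exact absurd (h2.trans h3) hmc.asymm
    obtain ⟨z, hz, hcz⟩ := key
    have := hmem z hz
    rw [Walk.support_cons, List.mem_cons] at this
    exact ⟨z, this.resolve_left (hmc.trans hcz).ne', hcz⟩
  obtain ⟨y, x, p₁, hyx, p₂, hW, hP, hx⟩ :=
    exists_exit (P := fun v => v < c) (q.takeUntil z hz) hlt hcz.not_gt
  have hsub : ∀ w ∈ (q.takeUntil z hz).support, w ∈ q.support := fun w hw =>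
    q.support_takeUntil_subset_support hz hw
  have hxq : x ∈ q.support := hsub x (by rw [hW]; simp)
  have hyq : y ∈ q.support := hsub y (by rw [hW]; simp)
  have hcx : c < x := by
    refine lt_of_le_of_ne (not_lt.1 hx) ?_
    rintro rfl
    exact hc.ne' (hpq c (by simp) (by simp [hxq]))
  have hyc : y < c := hP y p₁.end_mem_support
  have hmy : m < y := lt_of_le_of_ne (hqm y (by simp [hyq])) fun h => hq.2 (h ▸ hyq)
  have hyL := (h.mem_of_adj y x hyx (hyc.trans hcx)).1
  rcases h.near y x hyx (hyc.trans hcx) with hn | hn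
  · by_cases hnil : p₁.Nil
    · exact disj y hyL (hnil.eq ▸ hc'R)
    · exact absurd (hn _ (Walk.adj_penultimate hnil).symm)
        (not_le.2 ((hP _ (by simp)).trans hcx))
  · exact h.nocross_right m c y x hc hyx hmy hyc hcx hnear hn

theorem IsAlternatingSplit.not_hasFork {L R : Set V} (h : IsAlternatingSplit G L R) (ℓ : ℕ) :
    ¬ HasFork ℓ G := by
  rintro ⟨m, u, v, p, q, hp, hq, -, -, hpq, hpm, hqm, e, he, f, hf, hef⟩
  cases p with
  | nil => simp at he
  | @cons _ c _ hc p =>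
    cases q with
    | nil => simp at hf
    | @cons _ c' _ hc' q =>
      rcases lt_trichotomy c c' with hlt | rfl | hlt
      · exact h.not_edgesCross hc' hc hq hp (fun x hx hx' => hpq x hx' hx) hqm hpm hlt hf he
          hef.symm
      · exact hc.ne' (hpq c (by simp) (by simp))
      · exact h.not_edgesCross hc hc' hp hq hpq hpm hqm hlt he hf hef

end Alternating

/-! ### Trees without inner cut vertices -/

section Trees

theorem length_eq_one_of_isAcyclic {V : Type*} {G : SimpleGraph V} (hG : G.IsAcyclic) {a b : V}
    (h : G.Adj a b) {q : G.Walk a b}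
    (hq : q.IsPath) : q.length = 1 := by
  have h1 : (Walk.cons h Walk.nil).IsPath := by simp [h.ne]
  have := (hG.subsingleton_path a b).elim ⟨q, hq⟩ ⟨_, h1⟩
  rw [Subtype.mk.injEq] at this
  rw [this]
  rfl

theorem not_triangle_of_isAcyclic {V : Type*} {G : SimpleGraph V} (hG : G.IsAcyclic)
    {x y z : V} (hxy : G.Adj x y)
    (hyz : G.Adj y z) : ¬ G.Adj x z := by
  intro hxz
  have := length_eq_one_of_isAcyclic hG hxz (q := Walk.cons hxy (Walk.cons hyz Walk.nil))
    (by simp [hxy.ne, hyz.ne, hxz.ne])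
  simp at this

variable {V : Type*} [LinearOrder V] {G : SimpleGraph V}

/-- If `v` has the neighbors `z < v < w`, then a walk from `z` to the right of `v` that avoids `v`
leads to a fork or a bonnet at the leftmost vertex `m` before its first edge `yx` across `v`. -/
theorem no_straddling_walk (hG : G.IsAcyclic) (hB : ¬ HasLeftBonnet G) (hF : ∀ ℓ, ¬ HasFork ℓ G)
    {z v w t : V} (hzv : G.Adj v z) (hvw : G.Adj v w) (hz : z < v) (hw : v < w) (ht : v < t)
    (W : G.Walk z t) (hvW : v ∉ W.support) : False := by
  classical
  wlog hW : W.IsPath generalizing W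
  · exact this W.bypass (fun h => hvW (W.support_bypass_subset_support h)) W.bypass_isPath
  obtain ⟨y, x, p₁, hyx, p₂, rfl, hP, hx⟩ := exists_exit (P := fun u => u < v) W hz ht.not_gt
  have hxv : v < x := lt_of_le_of_ne (not_lt.1 hx) fun h => hvW (by rw [h]; simp)
  have hvp : v ∉ p₁.support := fun h => lt_irrefl _ (hP v h)
  have hxp : x ∉ p₁.support := fun h => hxv.asymm (hP x h)
  have hp₁ : p₁.IsPath := hW.of_append_left
  have hwp : w ∉ p₁.support := fun h => hw.asymm (hP w h)
  have hyv : y < v := hP y p₁.end_mem_support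
  have hxw : x ≠ w := by
    rintro rfl
    have := length_eq_one_of_isAcyclic hG hvw (q := (Walk.cons hzv p₁).concat hyx) (by
      refine Walk.IsPath.concat ?_ (by simp [hxp, hxv.ne']) _
      rw [Walk.cons_isPath_iff]
      exact ⟨hp₁, hvp⟩)
    simp at this
  have hA : (Walk.cons hzv p₁).IsPath := by
    rw [Walk.cons_isPath_iff]
    exact ⟨hp₁, hvp⟩
  obtain ⟨A, hAdef⟩ : ∃ A, A = Walk.cons hzv p₁ := ⟨_, rfl⟩
  rw [← hAdef] at hA
  have hAs : ∀ u ∈ A.support, u = v ∨ u ∈ p₁.support := by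
    intro u hu
    simpa [hAdef] using hu
  have hAlt : ∀ u ∈ A.support, u ≤ v := fun u hu => (hAs u hu).elim (·.le) fun h => (hP u h).le
  have hzA : z ∈ A.support := by simp [hAdef]
  have hyA : y ∈ A.support := by simp
  obtain ⟨m, hm, hmin⟩ := A.support.toFinset.exists_min_image id ⟨v, by simp⟩
  simp only [List.mem_toFinset, id] at hm hmin
  have hmv : m < v := (hmin z hzA).trans_lt hz
  have hxA : x ∉ A.support := fun h => (hAlt x h).not_gt hxv
  have hwA : w ∉ A.support := fun h => (hAlt w h).not_gt hw
  rcases lt_or_gt_of_ne hxw with hlt | hlt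
  · -- The edges `vw` and `yx` cross.
    obtain ⟨ℓ, hℓ⟩ := hasFork_of_extension hA hvw hyx hwA hxA hxw.symm hm hmin
      (hmv.le.trans hw.le) (hmv.le.trans hxv.le) (edgesCross_mk hyv hxv hlt).symm
    exact hF ℓ hℓ
  · -- The edge `yx` covers `vw`. For `m = y` this is a bonnet; otherwise the path from `m` back to
    -- `v` has an edge across `y`, which crosses `yx`.
    obtain ⟨A₁, A₂, rfl⟩ := Walk.mem_support_iff_exists_append.1 hm
    simp only [Walk.mem_support_append_iff, not_or] at hmin hxA hwA hAlt
    rcases eq_or_ne m y with rfl | hmy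
    · have hnil : ¬ A₁.Nil := fun h => hmv.ne h.eq.symm
      have hadj := Walk.adj_penultimate hnil
      have hmem : A₁.penultimate ∈ A₁.support := by simp
      have h1 : m < A₁.penultimate := lt_of_le_of_ne (hmin _ (Or.inl hmem)) hadj.ne'
      exact hB ⟨m, A₁.penultimate, v, w, x, h1, hAlt _ (Or.inl hmem), hw, hlt.le,
        fun h => hlt.ne h.2, hadj.symm, hyx, hvw⟩
    · have hmy' : m < y := lt_of_le_of_ne (hmin y (Or.inr A₂.end_mem_support)) hmy
      have hyA₁ : y ∉ A₁.support := fun h =>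
        hmy.symm (eq_of_mem_of_isPath_append hA h A₂.end_mem_support)
      obtain ⟨g, h, q₁, hgh, q₂, hq, hQ, hh⟩ :=
        exists_exit (P := fun u => u < y) A₁.reverse hmy' hyv.not_gt
      have hg' : g ∈ A₁.reverse.support := by rw [hq]; simp
      have hh' : h ∈ A₁.reverse.support := by rw [hq]; simp
      rw [Walk.support_reverse, List.mem_reverse] at hg' hh'
      have hyh : y < h := lt_of_le_of_ne (not_lt.1 hh) fun e => hyA₁ (e ▸ hh')
      obtain ⟨ℓ, hℓ⟩ := hasFork_of_walks (p := A₁.reverse) (q := A₂.concat hyx)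
        (e := s(g, h)) (f := s(y, x)) hA.of_append_left.reverse
        (hA.of_append_right.concat hxA.2 _)
        (by
          intro u hu hu'
          rw [Walk.support_reverse, List.mem_reverse] at hu
          simp only [Walk.support_concat, List.mem_append, List.mem_singleton] at hu'
          rcases hu' with hu' | rfl
          · exact eq_of_mem_of_isPath_append hA hu hu'
          · exact absurd hu hxA.1)
        (fun u hu => hmin u (Or.inl (by simpa using hu)))
        (by
          intro u hu
          simp only [Walk.support_concat, List.mem_append, List.mem_singleton] at hu
          rcases hu with hu | rfl
          exacts [hmin u (Or.inr hu), (hmv.trans hxv).le])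
        (by rw [hq]; simp) (by simp [Walk.edges_concat])
        (edgesCross_mk (hQ g q₁.end_mem_support) hyh ((hAlt h (Or.inl hh')).trans_lt hxv))
      exact hF ℓ hℓ

theorem not_adj_both_sides (hG : G.IsTree) (hB : ¬ HasLeftBonnet G)
    (hB' : ¬ HasLeftBonnet (V := Vᵒᵈ) G) (hF : ∀ ℓ, ¬ HasFork ℓ G)
    (hF' : ∀ ℓ, ¬ HasFork (V := Vᵒᵈ) ℓ G)
    (hcut : ∀ v, ¬ IsBot v → ¬ IsTop v → ∃ s t, G.Adj s t ∧ s < v ∧ v < t)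
    {u v w : V} (huv : G.Adj v u) (hvw : G.Adj v w) (hu : u < v) (hw : v < w) : False := by
  obtain ⟨s, t, hst, hs, ht⟩ := hcut v (fun h => (h u).not_gt hu) (fun h => (h w).not_gt hw)
  obtain ⟨P, hP⟩ := (hG.connected.preconnected v s).exists_isPath
  cases P with
  | nil => exact lt_irrefl _ hs
  | @cons _ z _ hvz P =>
    rw [Walk.cons_isPath_iff] at hP
    rcases lt_or_gt_of_ne hvz.ne' with hz | hz
    · exact no_straddling_walk hG.isAcyclic hB hF hvz hvw hz hw ht (P.concat hst)
        (by simpa [Walk.support_concat, ht.ne] using hP.2)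
    · exact no_straddling_walk (V := Vᵒᵈ) hG.isAcyclic hB' hF' hvz huv hz hu hs P hP.2

/-- If `r` were left of `l`, then on the path from `r` to `l` the leftmost vertex and the vertices
close to it would form a zigzag, unless `r` is next to the leftmost
vertex; then the first edge across `r` would complete a fork. -/
theorem lt_of_adj_right_of_adj_left (hG : G.IsTree) (hB : ¬ HasLeftBonnet G)
    (hF : ∀ ℓ, ¬ HasFork ℓ G)
    (hside : ∀ u v w, G.Adj v u → G.Adj v w → u < v → ¬ v < w)
    {l r x y : V} (hl : G.Adj l x) (hlx : l < x) (hr : G.Adj r y) (hry : y < r) : l < r := by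
  classical
  by_contra hlr
  have hright : ∀ u, G.Adj r u → u < r := fun u hu =>
    lt_of_le_of_ne (not_lt.1 (hside y r u hr hu hry)) hu.ne'
  have hleft : ∀ u, G.Adj l u → l < u := fun u hu =>
    lt_of_le_of_ne (not_lt.1 fun h => hside u l x hu hl h hlx) hu.ne
  have hrl : r < l := lt_of_le_of_ne (not_lt.1 hlr) fun h => (h ▸ hleft y (h ▸ hr)).asymm hry
  obtain ⟨Q, hQ⟩ := (hG.connected.preconnected r l).exists_isPath
  obtain ⟨m, hm, hmin⟩ := Q.support.toFinset.exists_min_image id ⟨r, by simp⟩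
  simp only [List.mem_toFinset, id] at hm hmin
  have hT : ∀ x y z, x < y → y < z → G.Adj x y → G.Adj y z → ¬ G.Adj x z :=
    fun x y z _ _ => not_triangle_of_isAcyclic hG.isAcyclic
  have hmr : m < r := by
    cases Q with
    | nil => exact absurd hrl (lt_irrefl _)
    | @cons _ z _ h Q => exact (hmin z (by simp)).trans_lt (hright z h)
  obtain ⟨A, B, rfl⟩ := Walk.mem_support_iff_exists_append.1 hm
  obtain ⟨A', hA'⟩ : ∃ A', A' = A.reverse := ⟨_, rfl⟩
  have hA'p : A'.IsPath := by rw [hA']; exact hQ.of_append_left.reverse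
  have hBp : B.IsPath := hQ.of_append_right
  have hAB : ∀ z ∈ A'.support, z ∈ B.support → z = m := fun z hz hz' =>
    eq_of_mem_of_isPath_append hQ (by simpa [hA'] using hz) hz'
  have hminA : ∀ z ∈ A'.support, m ≤ z := fun z hz => hmin z (by
    rw [Walk.mem_support_append_iff]; left; simpa [hA'] using hz)
  have hminB : ∀ z ∈ B.support, m ≤ z := fun z hz => hmin z (by
    rw [Walk.mem_support_append_iff]; exact Or.inr hz)
  clear hA' hQ hm hmin
  cases A' with
  | nil => exact lt_irrefl _ hmr
  | @cons _ b _ hmb A' =>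
    cases B with
    | nil => exact lt_irrefl _ (hmr.trans hrl)
    | @cons _ c _ hmc B =>
      have hb : m < b := lt_of_le_of_ne (hminA b (by simp)) hmb.ne
      have hc : m < c := lt_of_le_of_ne (hminB c (by simp)) hmc.ne
      rw [Walk.cons_isPath_iff] at hA'p hBp
      rcases lt_trichotomy b c with hbc | rfl | hbc
      · cases B with
        | nil => exact lt_asymm hc (hleft m hmc.symm)
        | @cons _ z _ hcz B =>
          have hz : m < z := lt_of_le_of_ne (hminB z (by simp)) fun h => hBp.2 (by simp [h])
          have hzc : z < c := lt_of_le_of_ne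
            (not_lt.1 (hside m c z hmc.symm hcz hc)) hcz.ne'
          exact no_zigzag hT hB hF hmb hmc hcz.symm hb hbc hz hzc
      · exact hmb.ne' (hAB b (by simp) (by simp))
      · cases A' with
        | nil =>
          have hbB : r ∉ (Walk.cons hmc B).support := fun h => hmb.ne' (hAB r (by simp) h)
          obtain ⟨y', x', p₁, hyx, p₂, hp, hP, hx'⟩ :=
            exists_exit (P := fun v => v < r) B hbc hrl.not_gt
          have hy'B : y' ∈ B.support := by rw [hp]; simp
          have hx'B : x' ∈ B.support := by rw [hp]; simp
          have hbx : r < x' := lt_of_le_of_ne (not_lt.1 hx') fun h => hbB (by simp [h, hx'B])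
          have hmy : m < y' := lt_of_le_of_ne (hminB y' (by simp [hy'B])) fun h =>
            hBp.2 (h ▸ hy'B)
          obtain ⟨ℓ, hℓ⟩ := hasFork_of_walks (p := Walk.cons hmb Walk.nil) (q := Walk.cons hmc B)
            (e := s(m, r)) (f := s(y', x')) (by simp [hmb.ne])
            (by rw [Walk.cons_isPath_iff]; exact hBp) hAB hminA hminB (by simp)
            (by rw [hp]; simp) (edgesCross_mk hmy (hP y' p₁.end_mem_support) hbx)
          exact hF ℓ hℓ
        | @cons _ z _ hbz A' =>
          have hz : m < z := lt_of_le_of_ne (hminA z (by simp)) fun h => hA'p.2 (by simp [h])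
          have hzb : z < b := lt_of_le_of_ne
            (not_lt.1 (hside m b z hmb.symm hbz hb)) hbz.ne'
          exact no_zigzag hT hB hF hmc hmb hbz.symm hc hbc hz hzb

/-- If the nearest edges of `r` and `r'` cross, then the path joining them completes a fork. -/
theorem not_cross_nearest (hG : G.Preconnected) (hF : ∀ ℓ, ¬ HasFork ℓ G) {l r l' r' : V}
    (hlr : G.Adj l r) (hlr' : G.Adj l' r') (h1 : l < l') (h2 : l' < r) (h3 : r < r')
    (hn : ∀ x, G.Adj x r → x ≤ l) (hn' : ∀ x, G.Adj x r' → x ≤ l') : False := by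
  obtain ⟨a, b, a', b', Q, hQ, hab, hab', hb, hb'⟩ := exists_path_between_edges hG hlr.ne hlr'.ne
  have hadj : G.Adj a b := by
    rw [← mem_edgeSet, hab]; exact hlr
  have hadj' : G.Adj a' b' := by
    rw [← mem_edgeSet, hab']; exact hlr'
  have haa : a ≠ a' ∧ b ≠ b' := by
    rcases Sym2.eq_iff.1 hab with ⟨rfl, rfl⟩ | ⟨rfl, rfl⟩ <;>
    rcases Sym2.eq_iff.1 hab' with ⟨rfl, rfl⟩ | ⟨rfl, rfl⟩
    exacts [⟨h1.ne, h3.ne⟩, ⟨(h1.trans (h2.trans h3)).ne, h2.ne'⟩,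
      ⟨h2.ne', (h1.trans (h2.trans h3)).ne⟩, ⟨h3.ne, h1.ne⟩]
  obtain ⟨m, hm, hmin⟩ := Q.support.toFinset.exists_min_image id ⟨a, by simp⟩
  simp only [List.mem_toFinset, id] at hm hmin
  have hnil : ¬ Q.Nil := fun h => haa.1 h.eq
  have hml : m ≤ l := by
    rcases Sym2.eq_iff.1 hab with ⟨rfl, rfl⟩ | ⟨rfl, rfl⟩
    · exact hmin a Q.start_mem_support
    · exact (hmin Q.snd (by simp)).trans (hn _ (Walk.adj_snd hnil).symm)
  have hml' : m ≤ l' := by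
    rcases Sym2.eq_iff.1 hab' with ⟨rfl, rfl⟩ | ⟨rfl, rfl⟩
    · exact hmin a' Q.end_mem_support
    · exact (hmin Q.penultimate (by simp)).trans (hn' _ (Walk.adj_penultimate hnil))
  obtain ⟨ℓ, hℓ⟩ := hasFork_of_extension hQ hadj hadj' hb hb' haa.2 hm hmin
    (by
      rcases Sym2.eq_iff.1 hab with ⟨rfl, rfl⟩ | ⟨rfl, rfl⟩
      exacts [hml.trans (h1.trans h2).le, hml])
    (by
      rcases Sym2.eq_iff.1 hab' with ⟨rfl, rfl⟩ | ⟨rfl, rfl⟩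
      exacts [hml'.trans (h2.trans h3).le, hml'])
    (by rw [hab, hab']; exact edgesCross_mk h1 h2 h3)
  exact hF ℓ hℓ

theorem exists_isAlternatingSplit [Nontrivial V] (hG : G.IsTree) (hB : ¬ HasLeftBonnet G)
    (hB' : ¬ HasLeftBonnet (V := Vᵒᵈ) G) (hF : ∀ ℓ, ¬ HasFork ℓ G)
    (hF' : ∀ ℓ, ¬ HasFork (V := Vᵒᵈ) ℓ G)
    (hcut : ∀ v, ¬ IsBot v → ¬ IsTop v → ∃ s t, G.Adj s t ∧ s < v ∧ v < t) :
    ∃ L R, IsAlternatingSplit G L R := by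
  have hside : ∀ u v w, G.Adj v u → G.Adj v w → u < v → ¬ v < w := fun u v w h1 h2 h3 h4 =>
    not_adj_both_sides hG hB hB' hF hF' hcut h1 h2 h3 h4
  have hT : ∀ x y z, x < y → y < z → G.Adj x y → G.Adj y z → ¬ G.Adj x z :=
    fun x y z _ _ => not_triangle_of_isAcyclic hG.isAcyclic
  refine ⟨{v | ∃ w, G.Adj v w ∧ v < w}, {v | ∃ w, G.Adj v w ∧ w < v}, ?_, ?_, ?_, ?_, ?_, ?_⟩
  · intro x
    obtain ⟨w, hw⟩ := hG.connected.preconnected.exists_adj_of_nontrivial x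
    exact (lt_or_gt_of_ne hw.ne).imp (fun h => ⟨w, hw, h⟩) (fun h => ⟨w, hw, h⟩)
  · rintro l ⟨x, hl, hlx⟩ r ⟨y, hr, hry⟩
    exact lt_of_adj_right_of_adj_left hG hB hF hside hl hlx hr hry
  · exact fun x y hxy h => ⟨⟨y, hxy, h⟩, ⟨x, hxy.symm, h⟩⟩
  · intro l r hlr h
    by_contra! hcon
    obtain ⟨⟨b, hb, hbr⟩, ⟨d, hd, hdl⟩⟩ := hcon
    have hlb : l < b := lt_of_le_of_ne (not_lt.1 fun h' => hside b l r hb hlr h' h) hb.ne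
    have hdr : d < r := lt_of_le_of_ne (not_lt.1 (hside l r d hlr.symm hd.symm h)) hd.ne
    exact no_zigzag hT hB hF hb hlr hd hlb hbr hdl hdr
  · exact fun l r l' r' h1 h2 h3 h4 h5 hn hn' => not_cross_nearest (V := Vᵒᵈ)
      hG.connected.preconnected hF' h2.symm h1.symm h5 h4 h3 (fun x hx => hn' x hx.symm)
      (fun x hx => hn x hx.symm)
  · exact fun l r l' r' h1 h2 h3 h4 h5 hn hn' =>
      not_cross_nearest hG.connected.preconnected hF h1 h2 h3 h4 h5 hn hn'

end Trees

/-! ### Segments -/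

section Segments

variable {V : Type*} [LinearOrder V] {G : SimpleGraph V}

theorem isInnerCutVertex_orderDual {v : V} :
    IsInnerCutVertex (V := Vᵒᵈ) G v ↔ IsInnerCutVertex G v := by
  constructor <;> rintro ⟨h, h1, h2⟩ <;>
  exact ⟨fun ⟨u, w, huw, hu, hw⟩ => h ⟨w, u, huw.symm, hw, hu⟩, h2, h1⟩

theorem IsSegment.of_dual {S : Set V} (h : IsSegment (V := Vᵒᵈ) G S) : IsSegment G S := by
  obtain ⟨hS, hc, a, b, ha, hb, ha', hb', hcut⟩ := h
  refine ⟨hS, ⟨fun x hx y hy z hz => hc.out hy hx ⟨hz.2, hz.1⟩⟩, b, a, hb, ha,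
    hb'.imp_left isInnerCutVertex_orderDual.1, ha'.imp_left isInnerCutVertex_orderDual.1,
    fun x hx hxb hxa hx' => hcut x hx hxa hxb (isInnerCutVertex_orderDual.2 hx')⟩

theorem mem_support_of_no_edge_across {x s t : V} (hx : ¬ ∃ u w, G.Adj u w ∧ u < x ∧ x < w)
    (p : G.Walk s t) (hs : s ≤ x) (ht : x ≤ t) : x ∈ p.support := by
  rcases hs.eq_or_lt with rfl | hs
  · simp
  obtain ⟨y, z, p₁, h, p₂, rfl, hP, hz⟩ := exists_exit (P := fun v => v < x) p hs ht.not_gt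
  rcases (not_lt.1 hz).eq_or_lt with rfl | hz
  · simp
  · exact absurd ⟨y, z, h, hP y p₁.end_mem_support, hz⟩ hx

/-- A path cannot go across a cut vertex and come back. -/
theorem le_of_mem_support {b s t : V} (hb : IsInnerCutVertex G b ∨ IsTop b) {p : G.Walk s t}
    (hp : p.IsPath) (hs : s ≤ b) (ht : t ≤ b) : ∀ z ∈ p.support, z ≤ b := by
  intro z hz
  by_contra hbz
  rw [not_le] at hbz
  have hcut := (hb.resolve_right fun h => (h z).not_gt hbz).1
  obtain ⟨p₁, p₂, rfl⟩ := Walk.mem_support_iff_exists_append.1 hz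
  have h1 := mem_support_of_no_edge_across hcut p₁ hs hbz.le
  have h2 := mem_support_of_no_edge_across hcut p₂.reverse ht hbz.le
  rw [Walk.support_reverse, List.mem_reverse] at h2
  exact hbz.ne (eq_of_mem_of_isPath_append hp h1 h2)

theorem IsSegment.support_subset {S : Set V} (hS : IsSegment G S) {s t : V} (hs : s ∈ S)
    (ht : t ∈ S) {p : G.Walk s t} (hp : p.IsPath) : ∀ z ∈ p.support, z ∈ S := by
  obtain ⟨-, hc, a, b, ha, hb, ha', hb', -⟩ := hS
  intro z hz
  exact hc.out ha.1 hb.1 ⟨le_of_mem_support (V := Vᵒᵈ) (b := a)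
    (ha'.imp_left isInnerCutVertex_orderDual.2) hp (ha.2 hs) (ha.2 ht) z hz,
    le_of_mem_support hb' hp (hb.2 hs) (hb.2 ht) z hz⟩

theorem IsSegment.isTree_induce {S : Set V} (hS : IsSegment G S) (hG : G.IsTree) :
    (G.induce S).IsTree := by
  have : Nonempty S := hS.1.nonempty.to_subtype
  refine ⟨⟨fun s t => ?_⟩, hG.isAcyclic.induce S⟩
  obtain ⟨p, hp⟩ := (hG.connected.preconnected s t).exists_isPath
  exact ⟨p.induce S (hS.support_subset s.2 t.2 hp)⟩

theorem IsSegment.exists_adj_across {S : Set V} (hS : IsSegment G S) (v : S) (hv : ¬ IsBot v)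
    (hv' : ¬ IsTop v) : ∃ s t : S, (G.induce S).Adj s t ∧ s < v ∧ v < t := by
  obtain ⟨-, hc, a, b, ha, hb, ha', hb', hcut⟩ := hS
  have hav : a < v := lt_of_le_of_ne (ha.2 v.2) fun h =>
    hv fun x => Subtype.coe_le_coe.1 (h ▸ ha.2 x.2)
  have hvb : v < b := lt_of_le_of_ne (hb.2 v.2) fun h =>
    hv' fun x => Subtype.coe_le_coe.1 (h ▸ hb.2 x.2)
  have hnot := hcut v v.2 hav.ne' hvb.ne
  obtain ⟨u, w, huw, hu, hw⟩ : ∃ u w, G.Adj u w ∧ u < v ∧ v < w := by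
    by_contra hno
    exact hnot ⟨hno, fun h => (h a).not_gt hav, fun h => (h b).not_gt hvb⟩
  have hau : a ≤ u := by
    by_contra hua
    rw [not_le] at hua
    rcases ha' with h | h
    exacts [h.1 ⟨u, w, huw, hua, hav.trans hw⟩, (h u).not_gt hua]
  have hwb : w ≤ b := by
    by_contra hbw
    rw [not_le] at hbw
    rcases hb' with h | h
    exacts [h.1 ⟨u, w, huw, hu.trans hvb, hbw⟩, (h w).not_gt hbw]
  exact ⟨⟨u, hc.out ha.1 hb.1 ⟨hau, hu.le.trans hvb.le⟩⟩,
    ⟨w, hc.out ha.1 hb.1 ⟨hav.le.trans hw.le, hwb⟩⟩, huw, hu, hw⟩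

theorem exists_segment [Finite V] {s t : V} (hst : s < t)
    (h : ∀ x, s < x → x < t → ¬ IsInnerCutVertex G x) :
    ∃ S, IsSegment G S ∧ Set.Icc s t ⊆ S := by
  have : Nonempty V := ⟨s⟩
  obtain ⟨x₀, hx₀⟩ := Finite.exists_min (id : V → V)
  obtain ⟨x₁, hx₁⟩ := Finite.exists_max (id : V → V)
  obtain ⟨a, ⟨has, ha⟩, hamax⟩ := Set.exists_max_image
    {x | x ≤ s ∧ (IsInnerCutVertex G x ∨ IsBot x)} id (Set.toFinite _) ⟨x₀, hx₀ s, Or.inr hx₀⟩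
  obtain ⟨b, ⟨htb, hb⟩, hbmin⟩ := Set.exists_min_image
    {x | t ≤ x ∧ (IsInnerCutVertex G x ∨ IsTop x)} id (Set.toFinite _) ⟨x₁, hx₁ t, Or.inr hx₁⟩
  have hab : a < b := has.trans_lt (hst.trans_le htb)
  refine ⟨Set.Icc a b, ⟨⟨a, ⟨le_rfl, hab.le⟩, b, ⟨hab.le, le_rfl⟩, hab.ne⟩, Set.ordConnected_Icc,
    a, b, isLeast_Icc hab.le, isGreatest_Icc hab.le, ha, hb, ?_⟩, Set.Icc_subset_Icc has htb⟩
  intro x hx hxa hxb hcut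
  rcases le_or_gt x s with hxs | hxs
  · exact hxa (le_antisymm (hamax x ⟨hxs, Or.inl hcut⟩) hx.1)
  rcases le_or_gt t x with hxt | hxt
  · exact hxb (le_antisymm hx.2 (hbmin x ⟨hxt, Or.inl hcut⟩))
  exact h x hxs hxt hcut

theorem exists_segment_hasLeftBonnet [Finite V] (h : HasLeftBonnet G) :
    ∃ S, IsSegment G S ∧ HasLeftBonnet (G.induce S) := by
  obtain ⟨u₁, u₂, u₃, u₄, u₅, h12, h23, h34, h45, hne, a12, a15, a34⟩ := h
  have h14 : u₁ < u₄ := h12.trans (h23.trans_lt h34)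
  obtain ⟨S, hS, hsub⟩ := exists_segment (G := G) (h14.trans_le h45)
    fun x hx hx' hcut => hcut.1 ⟨u₁, u₅, a15, hx, hx'⟩
  exact ⟨S, hS, ⟨u₁, hsub ⟨le_rfl, h14.le.trans h45⟩⟩,
    ⟨u₂, hsub ⟨h12.le, h23.trans (h34.le.trans h45)⟩⟩,
    ⟨u₃, hsub ⟨h12.le.trans h23, h34.le.trans h45⟩⟩, ⟨u₄, hsub ⟨h14.le, h45⟩⟩,
    ⟨u₅, hsub ⟨h14.le.trans h45, le_rfl⟩⟩, h12, h23, h34, h45,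
    fun h => hne ⟨congrArg Subtype.val h.1, congrArg Subtype.val h.2⟩, a12, a15, a34⟩

/-- A path can be cut off behind any of its edges. -/
theorem exists_prefix_of_mem_edges {V : Type*} {G : SimpleGraph V} {m u : V} (p : G.Walk m u)
    (hp : p.IsPath) {e : Sym2 V} (he : e ∈ p.edges) :
    ∃ (w : V) (p' : G.Walk m w), p'.IsPath ∧ e ∈ p'.edges ∧ (∀ x ∈ p'.support, x ∈ p.support) ∧
      w ∈ e := by
  induction p with
  | nil => simp at he
  | @cons a b c h p ih =>
    rw [Walk.cons_isPath_iff] at hp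
    rw [Walk.edges_cons, List.mem_cons] at he
    rcases he with rfl | he
    · exact ⟨b, Walk.cons h Walk.nil, by simp [h.ne], by simp, by simp, by simp⟩
    · obtain ⟨w, p', hp', he', hsub, hw⟩ := ih hp.1 he
      refine ⟨w, Walk.cons h p', ?_, by simp [he'], ?_, hw⟩
      · rw [Walk.cons_isPath_iff]
        exact ⟨hp', fun h' => hp.2 (hsub _ h')⟩
      · intro x hx
        rw [Walk.support_cons, List.mem_cons] at hx ⊢
        exact hx.imp_right (hsub x)

/-- No cut vertex lies strictly between the first vertex `m` of a fork and the rightmost end of its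
two crossing edges: to the left of the edges it would lie on both legs. -/
theorem exists_segment_hasFork [Finite V] {ℓ : ℕ} (h : HasFork ℓ G) :
    ∃ S, IsSegment G S ∧ ∃ ℓ', HasFork ℓ' (G.induce S) := by
  classical
  obtain ⟨m, u, v, p, q, hp, hq, -, -, hpq, hpm, hqm, e, he, f, hf, a, b, c, d, hef, h1, h2, h3⟩ :=
    h
  wlog hord : e = s(a, b) ∧ f = s(c, d) generalizing u v p q e f
  · exact this v u q p hq hp (fun x hx hx' => hpq x hx' hx) hqm hpm f hf e he hef.symm
      (hef.resolve_left hord)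
  obtain ⟨rfl, rfl⟩ := hord
  have hb : b ∈ p.support := p.snd_mem_support_of_mem_edges he
  have hd : d ∈ q.support := q.snd_mem_support_of_mem_edges hf
  have hma : m ≤ a := hpm a (p.fst_mem_support_of_mem_edges he)
  have hmd : m < d := hma.trans_lt (h1.trans (h2.trans h3))
  obtain ⟨S, hS, hsub⟩ := exists_segment (G := G) hmd (by
    intro x hx hx' hcut
    rcases le_or_gt x a with hxa | hxa
    · have hxp := mem_support_of_no_edge_across hcut.1 (p.takeUntil b hb) hx.le
        (hxa.trans (h1.trans h2).le)
      have hxq := mem_support_of_no_edge_across hcut.1 (q.takeUntil d hd) hx.le hx'.le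
      exact hx.ne' (hpq x (p.support_takeUntil_subset_support hb hxp)
        (q.support_takeUntil_subset_support hd hxq))
    rcases lt_or_ge x b with hxb | hxb
    · exact hcut.1 ⟨a, b, p.adj_of_mem_edges he, hxa, hxb⟩
    · exact hcut.1 ⟨c, d, q.adj_of_mem_edges hf, h2.trans_le hxb, hx'⟩)
  obtain ⟨w, p', hp', he', hps, hw⟩ := exists_prefix_of_mem_edges p hp he
  obtain ⟨z, q', hq', hf', hqs, hz⟩ := exists_prefix_of_mem_edges q hq hf
  have hmS : m ∈ S := hsub ⟨le_rfl, hmd.le⟩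
  have hwS : w ∈ S := hsub ⟨hpm w (hps w p'.end_mem_support), by
    rcases Sym2.mem_iff.1 hw with rfl | rfl
    exacts [(h1.trans (h2.trans h3)).le, h3.le]⟩
  have hzS : z ∈ S := hsub ⟨hqm z (hqs z q'.end_mem_support), by
    rcases Sym2.mem_iff.1 hz with rfl | rfl
    exacts [(h2.trans h3).le, le_rfl]⟩
  have hpS := hS.support_subset hmS hwS hp'
  have hqS := hS.support_subset hmS hzS hq'
  have hpath : ∀ {y : V} {r : G.Walk m y} (hr : ∀ x ∈ r.support, x ∈ S), r.IsPath →
      (r.induce S hr).IsPath := fun {y r} hr hr' =>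
    Walk.IsPath.of_map (f := (Embedding.induce S).toHom) (by rwa [Walk.map_induce])
  have hedge : ∀ {y : V} {r : G.Walk m y} (hr : ∀ x ∈ r.support, x ∈ S) {g : Sym2 V},
      g ∈ r.edges → ∃ g' ∈ (r.induce S hr).edges, g'.map Subtype.val = g := by
    intro y r hr g hg
    have hE : ((r.induce S hr).map (Embedding.induce S).toHom).edges = r.edges :=
      congrArg Walk.edges (Walk.map_induce r hr)
    rw [← hE, Walk.edges_map, List.mem_map] at hg
    exact hg
  obtain ⟨e', he'', hee⟩ := hedge hpS he'
  obtain ⟨f', hf'', hff⟩ := hedge hqS hf'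
  refine ⟨S, hS, hasFork_of_walks (hpath hpS hp') (hpath hqS hq') ?_ ?_ ?_ he'' hf'' ?_⟩
  · rintro ⟨x, hx⟩ hx1 hx2
    rw [Walk.support_induce, List.mem_attachWith] at hx1 hx2
    exact Subtype.ext (hpq x (hps x hx1) (hqs x hx2))
  · rintro ⟨x, hx⟩ hx1
    rw [Walk.support_induce, List.mem_attachWith] at hx1
    exact hpm x (hps x hx1)
  · rintro ⟨x, hx⟩ hx1
    rw [Walk.support_induce, List.mem_attachWith] at hx1
    exact hqm x (hqs x hx1)
  · rw [← edgesCross_map_iff (φ := (Subtype.val : S → V)) (fun _ _ h => h), hee, hff]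
    exact edgesCross_mk h1 h2 h3

theorem containsCopy_induce_dual (S : Set V) :
    ContainsCopy (V := {x : Vᵒᵈ // x ∈ S}) (W := (↥S)ᵒᵈ) (G.induce S) (G.induce S) :=
  ⟨Hom.id, fun _ _ h => h⟩

theorem containsCopy_induce (S : Set V) : ContainsCopy (G.induce S) G :=
  ⟨(Embedding.induce S).toHom, fun _ _ h => h⟩

theorem not_obstruction_of_segments [Finite V] (h : ∀ S : Set V, IsSegment G S →
      IsMonotonicallyAlternating (G.induce S)) :
    ¬ ContainsBonnet G ∧ ¬ ContainsTangledPath G := by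
  rw [containsBonnet_iff, containsTangledPath_iff]
  have hsplit : ∀ S : Set V, IsSegment G S → ∃ L R, IsAlternatingSplit (G.induce S) L R :=
    fun S hS => (isMonotonicallyAlternating_iff.1 (h S hS)).2
  constructor
  · rintro (hB | hB)
    · obtain ⟨S, hS, hB⟩ := exists_segment_hasLeftBonnet hB
      obtain ⟨L, R, hLR⟩ := hsplit S hS
      exact hLR.not_hasLeftBonnet hB
    · have : Finite Vᵒᵈ := ‹Finite V›
      obtain ⟨S, hS, hB⟩ := exists_segment_hasLeftBonnet (V := Vᵒᵈ) hB
      obtain ⟨L, R, hLR⟩ := hsplit S hS.of_dual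
      exact hLR.dual.not_hasLeftBonnet (hB.of_copy (containsCopy_induce_dual (V := V) S))
  · rintro ⟨ℓ, hF | hF⟩
    · obtain ⟨S, hS, ℓ', hF⟩ := exists_segment_hasFork hF
      obtain ⟨L, R, hLR⟩ := hsplit S hS
      exact hLR.not_hasFork ℓ' hF
    · have : Finite Vᵒᵈ := ‹Finite V›
      obtain ⟨S, hS, ℓ', hF⟩ := exists_segment_hasFork (V := Vᵒᵈ) hF
      obtain ⟨L, R, hLR⟩ := hsplit S hS.of_dual
      exact hLR.dual.not_hasFork ℓ' (hF.of_copy (containsCopy_induce_dual (V := V) S))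

theorem isMonotonicallyAlternating_of_isSegment [Finite V] (hG : G.IsTree)
    (hB : ¬ ContainsBonnet G) (hF : ¬ ContainsTangledPath G) {S : Set V} (hS : IsSegment G S) :
    IsMonotonicallyAlternating (G.induce S) := by
  simp only [containsBonnet_iff, containsTangledPath_iff, not_or, not_exists] at hB hF
  have : Nontrivial S := hS.1.coe_sort
  have hc : ContainsCopy (V := (↥S)ᵒᵈ) (W := Vᵒᵈ) (G.induce S) G :=
    ⟨(Embedding.induce S).toHom, fun _ _ h => h⟩
  exact isMonotonicallyAlternating_iff.2 ⟨hS.isTree_induce hG,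
    exists_isAlternatingSplit (hS.isTree_induce hG)
      (fun h => hB.1 (h.of_copy (containsCopy_induce S))) (fun h => hB.2 (h.of_copy hc))
      (fun ℓ h => (hF ℓ).1 (h.of_copy (containsCopy_induce S)))
      (fun ℓ h => (hF ℓ).2 (h.of_copy hc)) hS.exists_adj_across⟩

end Segments

end OrderedGraph

theorem theorem2 {V : Type*} [Finite V] [LinearOrder V] :
    (∀ T : SimpleGraph V, T.IsTree →
      ((¬ OrderedGraph.ContainsBonnet T ∧ ¬ OrderedGraph.ContainsTangledPath T) ↔
        ∀ S : Set V, OrderedGraph.IsSegment T S →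
          OrderedGraph.IsMonotonicallyAlternating (T.induce S))) ∧
    (∀ H : SimpleGraph V, H.Connected → OrderedGraph.fPrec H ≠ ⊤ →
      ∀ S : Set V, OrderedGraph.IsSegment H S →
        OrderedGraph.IsMonotonicallyAlternating (H.induce S)) := by
  refine ⟨fun T hT => ⟨fun h S hS => ?_, OrderedGraph.not_obstruction_of_segments⟩,
    fun H hH hf S hS => ?_⟩
  · exact OrderedGraph.isMonotonicallyAlternating_of_isSegment hT h.1 h.2 hS
  · obtain ⟨hB, hF, hT⟩ := OrderedGraph.no_obstruction_of_fPrec_ne_top hf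
    have hB' := hB
    have hF' := hF
    simp only [OrderedGraph.containsBonnet_iff, OrderedGraph.containsTangledPath_iff, not_or,
      not_exists] at hB' hF'
    exact OrderedGraph.isMonotonicallyAlternating_of_isSegment
      ⟨hH, OrderedGraph.isAcyclic_of_no_obstruction hT hB'.1 fun ℓ => (hF' ℓ).1⟩ hB hF hS
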